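/- **Setting.** Let $p\ge 2$ and $d\ge 1$ be integers and let $(S,g)$ be a $d$-dimensional smooth Riemannian manifold (without boundary, Hausdorff, second countable), for example a manifold of bounded geometry. Write $|\cdot|$ for the Riemannian volume on $S$ and for the Lebesgue measure on $\mathbb{R}^d$. Let $\Omega\subset S$ be open with compact closure. A *$p$-multiscale decomposition* of a set $\Omega$ is a family of non-empty measurable sets $\Omega_{n,k}\subset\Omega$ ($n\in\mathbb{N}_0$, $0\le k<p^n$) such that $\Omega_{0,0}=\Omega$; for each $n$ the sets $\Omega_{n,0},\dots,\Omega_{n,p^n-1}$ are pairwise disjoint; and, for all $n,k$, $\Omega_{n+1,pk+j}\subset\Omega_{n,k}$ for $0\le j<p$ and $|\Omega_{n,k}\setminus\bigcup_{j<p}\Omega_{n+1,pk+j}|=0$. For $\Omega\subset\mathbb{R}^d$ such a decomposition is *regular and strongly balanced* if $|\Omega_{n,k}|=p^{-n}|\Omega|$ for all $n,k$ and there are $c_1,c_2>0$ with $\operatorname{diam}\Omega_{n,k}\le c_1p^{-n/d}$ and $|\Omega_{n,k}\setminus(\Omega_{n,k}+h)|\le c_2|h|\,p^{-n(d-1)/d}$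 for all $n,k$ and $h\in\mathbb{R}^d$. For $\Omega\subset S$ it is *regular and strongly balanced* if there are $N\in\mathbb{N}_0$ and smooth parametrizations (inverses of local charts) $\Phi_K:\mathbb{R}^d\supset\tilde O_K\to O_K\subset S$, $0\le K<p^N$, such that for each $K$: $\overline{\Omega_{N,K}}\subset O_K$; the set $\Phi_K^{-1}(\Omega_{N,K})\subset\mathbb{R}^d$ is bounded and open with Lipschitz boundary; $|\Omega_{N,K}|=p^{-N}|\Omega|$; and the sets $\Phi_K^{-1}(\Omega_{N+n,p^nK+k})$, $n\in\mathbb{N}_0$, $0\le k<p^n$, form a regular strongly balanced $p$-multiscale decomposition of $\Phi_K^{-1}(\Omega_{N,K})$ in $\mathbb{R}^d$. Let $P_n$ be the orthogonal projector in $L^2(\Omega)$ (complex-valued functions, Riemannian volume) onto $V_n:=\operatorname{span}\{\mathbb{1}_{\Omega_{n,k}}:0\le k<p^n\}$. For $s>0$ put $$\|f\|_{A^s(\Omega)}^2:=\|P_0f\|^2_{L^2(\Omega)}+\sum_{n=0}^\infty p^{2ns/d}\|f-P_nf\|^2_{L^2(\Omega)},\qquad A^s(\Omega):=\{f\in L^2(\Omega):\|f\|_{A^s(\Omega)}<\infty\},$$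 and $A^0(\Omega):=L^2(\Omega)$. Let $\mathcal{Z}:=\{\mathrm{rad}\}\cup\{(n,k,\sigma): n\in\mathbb{N}_0,\ 0\le k<p^n,\ 1\le\sigma\le p-1\}$, $\nu(\mathrm{rad}):=-1$, $\nu(n,k,\sigma):=n$, and for $r\ge0$ let $\ell^2_r(\mathcal{Z})$ be the space of all $a\in\ell^2(\mathcal{Z})$ with $\|a\|^2_{\ell^2_r}:=\sum_z p^{2r\nu(z)}|a_z|^2<\infty$. On the span of the basis sequences $e_z$, $z\in\mathcal{Z}$, define the linear map $I_\Omega$ by $$I_\Omega e_{\mathrm{rad}}:=\mathbb{1}_\Omega,\qquad I_\Omega e_{(n,k,\sigma)}:=p^{n/2}\sum_{j=0}^{p-1}e^{2\pi i\sigma j/p}\,\mathbb{1}_{\Omega_{n+1,pk+j}}.$$ **Proposition.** Let $\Omega\subset S$ be open with compact closure, let $(\Omega_{n,k})$ be a regular strongly balanced $p$-multiscale decomposition of $\Omega$, and let $r\ge 0$ and $0\le s<1$ with $s\le rd$. Then $I_\Omega$ extends in a unique way to a bounded linear operator $\ell^2_r(\mathcal{Z})\to A^s(\Omega)$, and this operator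 is injective. If $s=rd$, it is an isomorphism (bijective with bounded inverse). -/

import Mathlib

open scoped Manifold ContDiff ENNReal NNReal

noncomputable section

/-! ### Riemannian volume -/

section RiemannianVolume

variable {d : ℕ} {S : Type*} [TopologicalSpace S] [ChartedSpace (EuclideanSpace ℝ (Fin d)) S]
  [IsManifold (𝓡 d) ∞ S]

/-- A smooth Riemannian metric on a `d`-dimensional smooth manifold `S` (without boundary). -/
abbrev SmoothMetric (d : ℕ) (S : Type*) [TopologicalSpace S]
    [ChartedSpace (EuclideanSpace ℝ (Fin d)) S] [IsManifold (𝓡 d) ∞ S] : Type _ :=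
  Bundle.ContMDiffRiemannianMetric (𝓡 d) ∞ (EuclideanSpace ℝ (Fin d))
    (fun x : S => TangentSpace (𝓡 d) x)

/-- The coordinate vector field `∂ᵢΦ(u)` of the parametrization `Φ = φ⁻¹` belonging to
the chart `φ`. -/
def coordVector (φ : OpenPartialHomeomorph S (EuclideanSpace ℝ (Fin d)))
    (u : EuclideanSpace ℝ (Fin d)) (i : Fin d) : TangentSpace (𝓡 d) (φ.symm u) :=
  mfderiv (𝓡 d) (𝓡 d) φ.symm u (EuclideanSpace.single i (1 : ℝ))

/-- The Gram matrix `(g(∂ᵢΦ, ∂ⱼΦ))ᵢⱼ` of the metric in the chart `φ`. -/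
def gramMatrix (g : SmoothMetric d S)
    (φ : OpenPartialHomeomorph S (EuclideanSpace ℝ (Fin d)))
    (u : EuclideanSpace ℝ (Fin d)) : Matrix (Fin d) (Fin d) ℝ :=
  Matrix.of fun i j => g.inner (φ.symm u) (coordVector φ u i) (coordVector φ u j)

variable [MeasurableSpace S]

/-- The Riemannian volume of the domain of the chart `φ`, seen as a measure on `S`: the image under
`Φ = φ⁻¹` of the measure `√(det g) du` on the coordinate domain. -/
def chartVolume (g : SmoothMetric d S)
    (φ : OpenPartialHomeomorph S (EuclideanSpace ℝ (Fin d))) : MeasureTheory.Measure S :=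
  ((MeasureTheory.volume.restrict φ.target).withDensity
    fun u => ENNReal.ofReal (Real.sqrt (gramMatrix g φ u).det)).map φ.symm

/-- The Riemannian volume measure. The measures `chartVolume g φ` coincide on the overlaps of the
chart domains, and on a second countable manifold their supremum (over all smooth charts) is the
measure that restricts to `chartVolume g φ` on the domain of each smooth chart `φ`. -/
def riemannianVolume (g : SmoothMetric d S) : MeasureTheory.Measure S :=
  ⨆ φ ∈ IsManifold.maximalAtlas (𝓡 d) ∞ S, chartVolume g φ

end RiemannianVolume

/-! ### Multiscale decompositions -/

/-- `D n k` (`n ∈ ℕ`, `0 ≤ k < p ^ n`) is a `p`-multiscale decomposition of `Ω`, where sizes of sets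
are measured by `μ`. The values `D n k` with `p ^ n ≤ k` are irrelevant. -/
structure IsMultiscaleDecomposition {X : Type*} [MeasurableSpace X] (μ : MeasureTheory.Measure X)
    (p : ℕ) (Ω : Set X) (D : ℕ → ℕ → Set X) : Prop where
  measurable : ∀ n k, k < p ^ n → MeasureTheory.NullMeasurableSet (D n k) μ
  nonempty : ∀ n k, k < p ^ n → (D n k).Nonempty
  subset : ∀ n k, k < p ^ n → D n k ⊆ Ω
  root : D 0 0 = Ω
  disjoint : ∀ n k l, k < p ^ n → l < p ^ n → k ≠ l → Disjoint (D n k) (D n l)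
  child_subset : ∀ n k j, k < p ^ n → j < p → D (n + 1) (p * k + j) ⊆ D n k
  exhaust : ∀ n k, k < p ^ n → μ (D n k \ ⋃ j < p, D (n + 1) (p * k + j)) = 0

/-- Regular strongly balanced `p`-multiscale decompositions in `ℝ^d`. -/
structure IsEuclideanRegularStronglyBalanced (p d : ℕ) (Ω : Set (EuclideanSpace ℝ (Fin d)))
    (D : ℕ → ℕ → Set (EuclideanSpace ℝ (Fin d))) : Prop where
  decomposition : IsMultiscaleDecomposition MeasureTheory.volume p Ω D
  strongly_balanced : ∀ n k, k < p ^ n →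
    MeasureTheory.volume (D n k) = MeasureTheory.volume Ω / (p : ℝ≥0∞) ^ n
  diam_le : ∃ c₁ : ℝ, 0 < c₁ ∧ ∀ n k, k < p ^ n →
    Metric.ediam (D n k) ≤ ENNReal.ofReal (c₁ * (p : ℝ) ^ (-((n : ℝ) / d)))
  translate_le : ∃ c₂ : ℝ, 0 < c₂ ∧ ∀ (h : EuclideanSpace ℝ (Fin d)) (n k : ℕ), k < p ^ n →
    MeasureTheory.volume (D n k \ ((fun x => x + h) '' D n k)) ≤
      ENNReal.ofReal (c₂ * ‖h‖ * (p : ℝ) ^ (-((n : ℝ) * ((d : ℝ) - 1) / d)))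

/-- `Ω ⊆ ℝ^d` has Lipschitz boundary: near each boundary point `q` there are Cartesian coordinates
`(y', y_d) = T x` centered at `q` in which `Ω` is the part above the graph of a Lipschitz
function `h`. -/
def HasLipschitzBoundary {d : ℕ} (Ω : Set (EuclideanSpace ℝ (Fin d))) : Prop :=
  ∀ q ∈ frontier Ω, ∃ ε : ℝ, 0 < ε ∧ ∃ a : ℝ, 0 < a ∧
    ∃ (T : EuclideanSpace ℝ (Fin d) ≃ᵃⁱ[ℝ] WithLp 2 (EuclideanSpace ℝ (Fin (d - 1)) × ℝ))
      (h : EuclideanSpace ℝ (Fin (d - 1)) → ℝ) (L : ℝ≥0),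
      T q = 0 ∧ LipschitzOnWith L h (Metric.ball 0 ε) ∧ h 0 = 0 ∧
      (∀ y ∈ Metric.ball 0 ε, |h y| < a) ∧
      Ω ∩ {x | (T x).fst ∈ Metric.ball 0 ε ∧ |(T x).snd| < 2 * a} =
        {x | (T x).fst ∈ Metric.ball 0 ε ∧ h (T x).fst < (T x).snd ∧ (T x).snd < 2 * a}

section ManifoldDecomposition

variable {d : ℕ} {S : Type*} [TopologicalSpace S] [ChartedSpace (EuclideanSpace ℝ (Fin d)) S]

/-- The set `Φ⁻¹(A)` for the parametrization `Φ = φ⁻¹ : φ.target → φ.source`. -/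
def inChart (φ : OpenPartialHomeomorph S (EuclideanSpace ℝ (Fin d))) (A : Set S) :
    Set (EuclideanSpace ℝ (Fin d)) :=
  φ.target ∩ φ.symm ⁻¹' A

/-- Regular strongly balanced `p`-multiscale decompositions of a subset `Ω` of a Riemannian
manifold: for some `N`, all pieces of generation `N` have the same Riemannian volume, and the
closure of each of them lies in the domain of a smooth chart in which the piece is a bounded open
set with Lipschitz boundary and its sub-pieces form a regular strongly balanced decomposition (with
respect to the Lebesgue measure of the chart). -/
structure IsRegularStronglyBalanced [IsManifold (𝓡 d) ∞ S] [MeasurableSpace S]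
    (g : SmoothMetric d S) (p : ℕ) (Ω : Set S) (D : ℕ → ℕ → Set S) : Prop where
  decomposition : IsMultiscaleDecomposition (riemannianVolume g) p Ω D
  charts : ∃ (N : ℕ) (φ : ℕ → OpenPartialHomeomorph S (EuclideanSpace ℝ (Fin d))),
    ∀ K, K < p ^ N →
      φ K ∈ IsManifold.maximalAtlas (𝓡 d) ∞ S ∧
      closure (D N K) ⊆ (φ K).source ∧
      IsOpen (inChart (φ K) (D N K)) ∧
      Bornology.IsBounded (inChart (φ K) (D N K)) ∧
      HasLipschitzBoundary (inChart (φ K) (D N K)) ∧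
      riemannianVolume g (D N K) = riemannianVolume g Ω / (p : ℝ≥0∞) ^ N ∧
      IsEuclideanRegularStronglyBalanced p d (inChart (φ K) (D N K))
        (fun n k => inChart (φ K) (D (N + n) (p ^ n * K + k)))

end ManifoldDecomposition

/-! ### Approximation spaces -/

section Approximation

variable {X : Type*} [MeasurableSpace X]

/-- The indicator function of `A` as an element of `L²(μ)` (defined as `0` if it is not square
integrable). -/
def indicatorL2 (μ : MeasureTheory.Measure X) (A : Set X) : MeasureTheory.Lp ℂ 2 μ :=
  open Classical in
  if h : MeasureTheory.MemLp (A.indicator fun _ => (1 : ℂ)) 2 μ then h.toLp _ else 0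

/-- The space `Vₙ` spanned by the indicator functions of the sets `D n k`, `0 ≤ k < p ^ n`. -/
def scaleSpace (μ : MeasureTheory.Measure X) (p : ℕ) (D : ℕ → ℕ → Set X) (n : ℕ) :
    Submodule ℂ (MeasureTheory.Lp ℂ 2 μ) :=
  Submodule.span ℂ (Set.range fun k : Fin (p ^ n) => indicatorL2 μ (D n k))

instance (μ : MeasureTheory.Measure X) (p : ℕ) (D : ℕ → ℕ → Set X) (n : ℕ) :
    FiniteDimensional ℂ (scaleSpace μ p D n) :=
  FiniteDimensional.span_of_finite ℂ (Set.finite_range _)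

/-- The orthogonal projector `Pₙ` of `L²(μ)` onto `Vₙ`. -/
def scaleProj (μ : MeasureTheory.Measure X) (p : ℕ) (D : ℕ → ℕ → Set X) (n : ℕ) :
    MeasureTheory.Lp ℂ 2 μ →L[ℂ] MeasureTheory.Lp ℂ 2 μ :=
  (scaleSpace μ p D n).starProjection

/-- The weights `p ^ (n s / d)` for `s ≠ 0`. For `s = 0` only the term `n = 0` is kept, so that the
space `A⁰` below is `L²` with its usual norm
(`‖P₀ f‖² + ‖f - P₀ f‖² = ‖f‖²`). -/
def approxWeight (p d : ℕ) (s : ℝ) (n : ℕ) : ℝ :=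
  if s = 0 ∧ n ≠ 0 then 0 else (p : ℝ) ^ ((n : ℝ) * s / d)

/-- The sequence `p ^ (n s / d) (f - Pₙ f)`, `n ∈ ℕ`. -/
def approxError (μ : MeasureTheory.Measure X) (p d : ℕ) (D : ℕ → ℕ → Set X) (s : ℝ) :
    MeasureTheory.Lp ℂ 2 μ →ₗ[ℂ] (ℕ → MeasureTheory.Lp ℂ 2 μ) where
  toFun f n := (approxWeight p d s n : ℂ) • (f - scaleProj μ p D n f)
  map_add' f g := by
    funext n
    simp only [map_add, Pi.add_apply, ← smul_add]
    congr 1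
    abel
  map_smul' c f := by
    funext n
    simp only [map_smul, Pi.smul_apply, RingHom.id_apply, ← smul_sub]
    rw [smul_comm]

/-- The functions `f ∈ L²(μ)` such that `∑ₙ p ^ (2 n s / d) ‖f - Pₙ f‖² < ∞` (for `s = 0`: all
of `L²(μ)`). -/
def approxSubmodule (μ : MeasureTheory.Measure X) (p d : ℕ) (D : ℕ → ℕ → Set X) (s : ℝ) :
    Submodule ℂ (MeasureTheory.Lp ℂ 2 μ) where
  carrier := {f | Memℓp (approxError μ p d D s f) 2}
  zero_mem' := by
    simp only [Set.mem_ofPred_eq, map_zero]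
    exact zero_memℓp
  add_mem' {f g} hf hg := by
    simp only [Set.mem_ofPred_eq, map_add]
    exact Memℓp.add hf hg
  smul_mem' c f hf := by
    simp only [Set.mem_ofPred_eq, map_smul]
    exact Memℓp.const_smul hf c

/-- The approximation space `A^s` of the decomposition `D`. -/
def ApproxSpace (μ : MeasureTheory.Measure X) (p d : ℕ) (D : ℕ → ℕ → Set X) (s : ℝ) : Type _ :=
  ↥(approxSubmodule μ p d D s)

namespace ApproxSpace

variable (μ : MeasureTheory.Measure X) (p d : ℕ) (D : ℕ → ℕ → Set X) (s : ℝ)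

instance : AddCommGroup (ApproxSpace μ p d D s) :=
  inferInstanceAs (AddCommGroup ↥(approxSubmodule μ p d D s))

instance : Module ℂ (ApproxSpace μ p d D s) :=
  inferInstanceAs (Module ℂ ↥(approxSubmodule μ p d D s))

/-- The inclusion `A^s ⊆ L²(μ)`. -/
def toL2 : ApproxSpace μ p d D s →ₗ[ℂ] MeasureTheory.Lp ℂ 2 μ :=
  (approxSubmodule μ p d D s).subtype

/-- The map `f ↦ (P₀ f, (p ^ (n s / d) (f - Pₙ f))ₙ)` from which the norm of `A^s` is pulled back. -/
def normMap : ApproxSpace μ p d D s →ₗ[ℂ]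
    WithLp 2 (MeasureTheory.Lp ℂ 2 μ × lp (fun _ : ℕ => MeasureTheory.Lp ℂ 2 μ) 2) where
  toFun f := WithLp.toLp 2 (scaleProj μ p D 0 (toL2 μ p d D s f),
    ⟨approxError μ p d D s (toL2 μ p d D s f), f.2⟩)
  map_add' f g := by
    refine WithLp.ofLp_injective 2 (Prod.ext ?_ (Subtype.ext ?_))
    · simp
    · exact (congrArg _ (map_add _ f g)).trans (map_add _ _ _)
  map_smul' c f := by
    refine WithLp.ofLp_injective 2 (Prod.ext ?_ (Subtype.ext ?_))
    · simp
    · exact (congrArg _ (map_smul _ c f)).trans (map_smul _ _ _)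

theorem normMap_injective : Function.Injective (normMap μ p d D s) := by
  refine (injective_iff_map_eq_zero _).2 fun f hf => Subtype.ext ?_
  have h1 : scaleProj μ p D 0 (toL2 μ p d D s f) = 0 := congrArg WithLp.fst hf
  have h2 : approxError μ p d D s (toL2 μ p d D s f) 0 = 0 :=
    congrFun (congrArg Subtype.val (congrArg WithLp.snd hf)) 0
  have h3 : toL2 μ p d D s f = 0 := by simpa [approxError, approxWeight, h1] using h2
  exact h3

/-- The norm `‖f‖² = ‖P₀ f‖² + ∑ₙ p ^ (2 n s / d) ‖f - Pₙ f‖²` on `A^s`. -/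
instance : NormedAddCommGroup (ApproxSpace μ p d D s) :=
  NormedAddCommGroup.induced _ _ (normMap μ p d D s) (normMap_injective μ p d D s)

instance : NormedSpace ℂ (ApproxSpace μ p d D s) :=
  NormedSpace.induced ℂ (ApproxSpace μ p d D s) _ (normMap μ p d D s)

end ApproxSpace

end Approximation

/-! ### The sequence spaces `ℓ²_r(𝒵)` -/

/-- The index set `𝒵 = {rad} ∪ {(n, k, σ) : n ∈ ℕ, 0 ≤ k < p ^ n, 1 ≤ σ ≤ p - 1}`; the element
`node n k t` stands for `(n, k, t + 1)`. -/
inductive TreeIndex (p : ℕ) : Type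
  | rad : TreeIndex p
  | node (n : ℕ) (k : Fin (p ^ n)) (t : Fin (p - 1)) : TreeIndex p

/-- The generation `ν(rad) = -1`, `ν(n, k, σ) = n`. -/
def TreeIndex.gen {p : ℕ} : TreeIndex p → ℤ
  | .rad => -1
  | .node n _ _ => n

/-- The sequence `(p ^ (r ν(z)) a_z)`. -/
def weightSeq (p : ℕ) (r : ℝ) : (TreeIndex p → ℂ) →ₗ[ℂ] (TreeIndex p → ℂ) where
  toFun a z := (((p : ℝ) ^ (r * (z.gen : ℝ)) : ℝ) : ℂ) * a z
  map_add' a b := by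
    funext z
    simp [mul_add]
  map_smul' c a := by
    funext z
    simp [mul_left_comm]

/-- The sequences `a ∈ ℓ²(𝒵)` with `(p ^ (r ν(z)) a_z) ∈ ℓ²(𝒵)`. -/
def weightedSubmodule (p : ℕ) (r : ℝ) : Submodule ℂ (TreeIndex p → ℂ) where
  carrier := {a | Memℓp a 2 ∧ Memℓp (weightSeq p r a) 2}
  zero_mem' := by
    simp only [Set.mem_ofPred_eq, map_zero]
    exact ⟨zero_memℓp, zero_memℓp⟩
  add_mem' {a b} ha hb := by
    simp only [Set.mem_ofPred_eq, map_add]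
    exact ⟨ha.1.add hb.1, ha.2.add hb.2⟩
  smul_mem' c a ha := by
    simp only [Set.mem_ofPred_eq, map_smul]
    exact ⟨ha.1.const_smul c, ha.2.const_smul c⟩

/-- The space `ℓ²_r(𝒵)`. -/
def WeightedSeq (p : ℕ) (r : ℝ) : Type :=
  ↥(weightedSubmodule p r)

namespace WeightedSeq

variable (p : ℕ) (r : ℝ)

instance : AddCommGroup (WeightedSeq p r) :=
  inferInstanceAs (AddCommGroup ↥(weightedSubmodule p r))

instance : Module ℂ (WeightedSeq p r) :=
  inferInstanceAs (Module ℂ ↥(weightedSubmodule p r))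

/-- The sequence underlying an element of `ℓ²_r(𝒵)`. -/
def toFun : WeightedSeq p r →ₗ[ℂ] (TreeIndex p → ℂ) :=
  (weightedSubmodule p r).subtype

/-- The map `a ↦ (p ^ (r ν(z)) a_z)` from `ℓ²_r(𝒵)` to `ℓ²(𝒵)` from which the norm is pulled
back. -/
def normMap : WeightedSeq p r →ₗ[ℂ] lp (fun _ : TreeIndex p => ℂ) 2 where
  toFun a := ⟨weightSeq p r (toFun p r a), a.2.2⟩
  map_add' a b := Subtype.ext ((congrArg _ (map_add _ a b)).trans (map_add _ _ _))
  map_smul' c a := Subtype.ext ((congrArg _ (map_smul _ c a)).trans (map_smul _ _ _))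

theorem normMap_injective [p.AtLeastTwo] : Function.Injective (normMap p r) := by
  refine (injective_iff_map_eq_zero _).2 fun a ha => Subtype.ext (funext fun z => ?_)
  have h1 : weightSeq p r (toFun p r a) z = 0 := congrFun (congrArg Subtype.val ha) z
  have h2 : ((((p : ℝ) ^ (r * (z.gen : ℝ)) : ℝ) : ℂ)) ≠ 0 := by
    have hp : (0 : ℝ) < p := by
      have := Nat.AtLeastTwo.prop (n := p)
      exact_mod_cast (by omega : 0 < p)
    exact_mod_cast (Real.rpow_pos_of_pos hp _).ne'
  exact (mul_eq_zero.1 h1).resolve_left h2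

/-- The norm `‖a‖² = ∑ p ^ (2 r ν(z)) |a_z|²` on `ℓ²_r(𝒵)`. -/
instance [p.AtLeastTwo] : NormedAddCommGroup (WeightedSeq p r) :=
  NormedAddCommGroup.induced _ _ (normMap p r) (normMap_injective p r)

instance [p.AtLeastTwo] : NormedSpace ℂ (WeightedSeq p r) :=
  NormedSpace.induced ℂ (WeightedSeq p r) _ (normMap p r)

theorem memℓp_of_finite_support {a : TreeIndex p → ℂ} (ha : (Function.support a).Finite) :
    Memℓp a 2 :=
  (memℓp_zero ha).of_exponent_ge zero_le

/-- The inclusion of the finitely supported sequences, i.e. of the linear span of the basis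
sequences `e_z`, into `ℓ²_r(𝒵)`. -/
def ofFinsupp : (TreeIndex p →₀ ℂ) →ₗ[ℂ] WeightedSeq p r where
  toFun a := ⟨a, memℓp_of_finite_support p a.hasFiniteSupport,
    memℓp_of_finite_support p (a.hasFiniteSupport.subset fun _ hz => right_ne_zero_of_mul hz)⟩
  map_add' _ _ := rfl
  map_smul' _ _ := rfl

end WeightedSeq

/-! ### The identification operator -/

/-- The images of the basis sequences: `e_rad ↦ 1_Ω` and
`e_(n,k,σ) ↦ p ^ (n / 2) ∑ⱼ θ_σ ^ j 1_(D (n + 1) (p k + j))` with `θ_σ = exp (2 π i σ / p)`. -/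
def identVec {X : Type*} [MeasurableSpace X] (μ : MeasureTheory.Measure X) (p : ℕ) (Ω : Set X)
    (D : ℕ → ℕ → Set X) : TreeIndex p → MeasureTheory.Lp ℂ 2 μ
  | .rad => indicatorL2 μ Ω
  | .node n k t => (((p : ℝ) ^ ((n : ℝ) / 2) : ℝ) : ℂ) • ∑ j ∈ Finset.range p,
      Complex.exp (2 * Real.pi * Complex.I / p * ((t : ℕ) + 1 : ℂ)) ^ j •
        indicatorL2 μ (D (n + 1) (p * (k : ℕ) + j))

/-- The identification operator `I_Ω`, defined on the linear span of the basis sequences `e_z`. -/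
def identMap {X : Type*} [MeasurableSpace X] (μ : MeasureTheory.Measure X) (p : ℕ) (Ω : Set X)
    (D : ℕ → ℕ → Set X) : (TreeIndex p →₀ ℂ) →ₗ[ℂ] MeasureTheory.Lp ℂ 2 μ :=
  Finsupp.linearCombination ℂ (identVec μ p Ω D)

end

set_option linter.unusedSectionVars false
open MeasureTheory

/-! The Riemannian volume μ on Ω need not be balanced beyond generation `N`, so the Haar-type
vectors `identVec` are in general not orthogonal in L²(μ). The remedy is an auxiliary measure ν,
comparable to μ on Ω, with ν(D n k) = p^(-n) for all n and k: on each piece of generation `N` it is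
the Lebesgue measure of the chart, normalized to mass p^(-N) (`exists_balanced_measure`).
Comparability holds because the metric density is continuous and positive on the compact closures of
these pieces.

In L²(ν), the orthogonality of p-th roots of unity makes the vectors orthonormal
(`orthonormal_treeVec`). Those of generation below n span Vₙ (`treeSpan_eq_span_treeVec`), and all
of them together are total, since the pieces shrink to points (`eventually_subset`, `dense_span`).
Exchanging sums turns the approximation energy into a weighted ℓ² sum of the coefficients, the
weight at z being the sum of p^(2ns/d) over n ≤ gen z. For s > 0 this is a geometric sum comparable
to its last term p^(2s·gen z/d): it is dominated by p^(2r·gen z) when s ≤ rd, and comparable to it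
when s = rd. The root and the case s = 0 are treated separately.

The identity L²(ν) → L²(μ) is an isomorphism carrying Vₙ onto Vₙ. The orthogonal projectors differ,
but errors of best approximation change only by a factor independent of n
(`norm_sub_starProjection_map_le`), so the estimates pass to μ in
`exists_identification_of_comparable`. -/

noncomputable section

/-! ### Riemannian volume in charts -/

section Riemannian

variable {d : ℕ} {S : Type*} [TopologicalSpace S] [ChartedSpace (EuclideanSpace ℝ (Fin d)) S]
  [IsManifold (𝓡 d) ∞ S] (g : SmoothMetric d S)
  {φ ψ : OpenPartialHomeomorph S (EuclideanSpace ℝ (Fin d))}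

/-- The Gram matrix of the images of the standard basis vectors under `A`. -/
def formGram (b : EuclideanSpace ℝ (Fin d) →L[ℝ] EuclideanSpace ℝ (Fin d) →L[ℝ] ℝ)
    (A : EuclideanSpace ℝ (Fin d) →L[ℝ] EuclideanSpace ℝ (Fin d)) : Matrix (Fin d) (Fin d) ℝ :=
  Matrix.of fun i j => b (A (EuclideanSpace.single i 1)) (A (EuclideanSpace.single j 1))

theorem formGram_quadratic
    (b : EuclideanSpace ℝ (Fin d) →L[ℝ] EuclideanSpace ℝ (Fin d) →L[ℝ] ℝ)
    (A : EuclideanSpace ℝ (Fin d) →L[ℝ] EuclideanSpace ℝ (Fin d)) (x : Fin d → ℝ) :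
    x ⬝ᵥ (formGram b A).mulVec x = b (A (WithLp.toLp 2 x)) (A (WithLp.toLp 2 x)) := by
  have : WithLp.toLp 2 x = ∑ i, x i • EuclideanSpace.single i (1 : ℝ) := by
    ext j
    simp [Finset.sum_apply, Pi.single_apply]
  simp only [this, map_sum, map_smul, FunLike.coe_sum, Finset.sum_apply, smul_apply, dotProduct,
    Matrix.mulVec, formGram, Matrix.of_apply, smul_eq_mul, Finset.mul_sum]
  rw [Finset.sum_comm]
  refine Finset.sum_congr rfl fun i _ => Finset.sum_congr rfl fun j _ => ?_
  ring

/-- With M the matrix of J, the Gram matrix becomes Mᵀ G M, and each outer factor contributes det J.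
-/
theorem formGram_comp_det
    (b : EuclideanSpace ℝ (Fin d) →L[ℝ] EuclideanSpace ℝ (Fin d) →L[ℝ] ℝ)
    (A J : EuclideanSpace ℝ (Fin d) →L[ℝ] EuclideanSpace ℝ (Fin d)) :
    (formGram b (A ∘L J)).det = J.det ^ 2 * (formGram b A).det := by
  set M : Matrix (Fin d) (Fin d) ℝ := LinearMap.toMatrix
    (EuclideanSpace.basisFun (Fin d) ℝ).toBasis (EuclideanSpace.basisFun (Fin d) ℝ).toBasis
    (J : EuclideanSpace ℝ (Fin d) →ₗ[ℝ] EuclideanSpace ℝ (Fin d)) with hM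
  have hdet : M.det = J.det := LinearMap.det_toMatrix _ _
  have hcol : ∀ i, J (EuclideanSpace.single i 1) =
      ∑ k, M k i • EuclideanSpace.single k (1 : ℝ) := by
    intro i
    ext k
    simp [hM, LinearMap.toMatrix_apply, Finset.sum_apply, Pi.single_apply]
  have hG : formGram b (A ∘L J) = M.transpose * formGram b A * M := by
    ext i j
    simp only [formGram, Matrix.of_apply, ContinuousLinearMap.comp_apply, hcol, map_sum, map_smul,
      FunLike.coe_sum, Finset.sum_apply, smul_apply, Matrix.mul_apply, Matrix.transpose_apply,
      smul_eq_mul, Finset.mul_sum, Finset.sum_mul]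
    refine Finset.sum_congr rfl fun k _ => Finset.sum_congr rfl fun l _ => ?_
    ring
  rw [hG, Matrix.det_mul, Matrix.det_mul, Matrix.det_transpose, hdet]
  ring

/-- The value of the metric at `x`, as a bilinear form on the model space. -/
def metricForm (x : S) :
    EuclideanSpace ℝ (Fin d) →L[ℝ] EuclideanSpace ℝ (Fin d) →L[ℝ] ℝ := g.inner x

theorem mdifferentiableAt_chart_symm (hφ : φ ∈ IsManifold.maximalAtlas (𝓡 d) ∞ S)
    {u : EuclideanSpace ℝ (Fin d)} (hu : u ∈ φ.target) :
    MDifferentiableAt (𝓡 d) (𝓡 d) φ.symm u :=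
  ((contMDiffOn_symm_of_mem_maximalAtlas hφ).contMDiffAt
    (φ.open_target.mem_nhds hu)).mdifferentiableAt (by simp)

theorem mdifferentiableAt_chart (hφ : φ ∈ IsManifold.maximalAtlas (𝓡 d) ∞ S)
    {x : S} (hx : x ∈ φ.source) :
    MDifferentiableAt (𝓡 d) (𝓡 d) φ x :=
  ((contMDiffOn_of_mem_maximalAtlas hφ).contMDiffAt
    (φ.open_source.mem_nhds hx)).mdifferentiableAt (by simp)

theorem continuous_constant_tangentVector (v : EuclideanSpace ℝ (Fin d)) :
    Continuous fun u : EuclideanSpace ℝ (Fin d) =>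
      (⟨u, v⟩ : TangentBundle (𝓡 d) (EuclideanSpace ℝ (Fin d))) :=
  (tangentBundleModelSpaceHomeomorph (𝓡 d)).symm.continuous.comp
    (continuous_id.prodMk continuous_const)

theorem continuousOn_coordVector (hφ : φ ∈ IsManifold.maximalAtlas (𝓡 d) ∞ S) (i : Fin d) :
    ContinuousOn (fun u => (⟨φ.symm u, coordVector φ u i⟩ : TangentBundle (𝓡 d) S)) φ.target := by
  have : IsManifold (𝓡 d) 1 S := IsManifold.of_le (n := ∞) (by simp)
  have h := (contMDiffOn_symm_of_mem_maximalAtlas hφ).continuousOn_tangentMapWithin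
    (by simp) φ.open_target.uniqueMDiffOn
  have h3 : ContinuousOn (fun u => tangentMapWithin (𝓡 d) (𝓡 d) φ.symm φ.target
      ⟨u, EuclideanSpace.single i (1 : ℝ)⟩) φ.target :=
    h.comp (continuous_constant_tangentVector (EuclideanSpace.single i (1 : ℝ))).continuousOn
      fun u hu => hu
  refine h3.congr fun u hu => ?_
  have h4 := tangentMapWithin_eq_tangentMap (p := (⟨u, EuclideanSpace.single i (1 : ℝ)⟩ :
    TangentBundle (𝓡 d) (EuclideanSpace ℝ (Fin d)))) (φ.open_target.uniqueMDiffOn u hu)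
    (mdifferentiableAt_chart_symm hφ hu)
  exact h4.symm

theorem continuousOn_gramMatrix (hφ : φ ∈ IsManifold.maximalAtlas (𝓡 d) ∞ S) :
    ContinuousOn (gramMatrix g φ) φ.target := by
  refine continuousOn_pi.2 fun i => continuousOn_pi.2 fun j => ?_
  have hg := g.contMDiff.continuous.comp_continuousOn φ.continuousOn_symm
  have h := hg.clm_bundle_apply₂ (F₁ := EuclideanSpace ℝ (Fin d)) (F₂ := EuclideanSpace ℝ (Fin d))
    (E₃ := Bundle.Trivial S ℝ)
    (continuousOn_coordVector hφ i) (continuousOn_coordVector hφ j)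
  intro u hu
  have := h u hu
  simp only [FiberBundle.continuousWithinAt_totalSpace] at this
  exact this.2

/-- The derivative of the parametrization, as an endomorphism of the model space. -/
def paramDeriv (φ : OpenPartialHomeomorph S (EuclideanSpace ℝ (Fin d)))
    (u : EuclideanSpace ℝ (Fin d)) :
    EuclideanSpace ℝ (Fin d) →L[ℝ] EuclideanSpace ℝ (Fin d) :=
  mfderiv (𝓡 d) (𝓡 d) φ.symm u

theorem gramMatrix_eq_formGram (u : EuclideanSpace ℝ (Fin d)) :
    gramMatrix g φ u = formGram (metricForm g (φ.symm u)) (paramDeriv φ u) := rfl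

/-- The chain rule for `φ ∘ φ.symm = id` near u provides a left inverse of the derivative. -/
theorem paramDeriv_injective (hφ : φ ∈ IsManifold.maximalAtlas (𝓡 d) ∞ S)
    {u : EuclideanSpace ℝ (Fin d)} (hu : u ∈ φ.target) : Function.Injective (paramDeriv φ u) := by
  have hinj := mfderiv_comp u (mdifferentiableAt_chart hφ (φ.map_target hu))
    (mdifferentiableAt_chart_symm hφ hu)
  have hid : (φ ∘ φ.symm) =ᶠ[nhds u] id := by
    filter_upwards [φ.open_target.mem_nhds hu] with w hw using φ.right_inv hw
  rw [hid.mfderiv_eq, mfderiv_id] at hinj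
  exact Function.LeftInverse.injective (g := mfderiv (𝓡 d) (𝓡 d) φ (φ.symm u))
    fun x => (DFunLike.congr_fun hinj x).symm

theorem gramMatrix_det_pos (hφ : φ ∈ IsManifold.maximalAtlas (𝓡 d) ∞ S)
    {u : EuclideanSpace ℝ (Fin d)} (hu : u ∈ φ.target) : 0 < (gramMatrix g φ u).det := by
  refine Matrix.PosDef.det_pos (Matrix.PosDef.of_dotProduct_mulVec_pos ?_ fun x hx => ?_)
  · ext i j
    exact g.symm _ _ _
  · rw [star_trivial, gramMatrix_eq_formGram, formGram_quadratic]
    refine g.pos _ _ fun h0 => hx ?_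
    have h4 := paramDeriv_injective hφ hu (h0.trans (map_zero (paramDeriv φ u)).symm)
    simpa using congrArg WithLp.ofLp h4

/-- Transformation of the Gram determinant under a change of charts. -/
theorem gramMatrix_det_change (hφ : φ ∈ IsManifold.maximalAtlas (𝓡 d) ∞ S)
    (hψ : ψ ∈ IsManifold.maximalAtlas (𝓡 d) ∞ S)
    {u : EuclideanSpace ℝ (Fin d)} (hu : u ∈ φ.target) (hu' : φ.symm u ∈ ψ.source) :
    DifferentiableAt ℝ (ψ ∘ φ.symm) u ∧
    (gramMatrix g φ u).det = (fderiv ℝ (ψ ∘ φ.symm) u).det ^ 2 *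
      (gramMatrix g ψ (ψ (φ.symm u))).det := by
  have hd : MDifferentiableAt (𝓡 d) (𝓡 d) (ψ ∘ φ.symm) u :=
    (mdifferentiableAt_chart hψ hu').comp u (mdifferentiableAt_chart_symm hφ hu)
  refine ⟨mdifferentiableAt_iff_differentiableAt.1 hd, ?_⟩
  have hAB : paramDeriv φ u =
      paramDeriv ψ (ψ (φ.symm u)) ∘L fderiv ℝ (ψ ∘ φ.symm) u := by
    have h1 := mfderiv_comp u (mdifferentiableAt_chart_symm hψ (ψ.map_source hu')) hd
    have h2 : (ψ.symm ∘ (ψ ∘ φ.symm)) =ᶠ[nhds u] φ.symm := by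
      filter_upwards [(φ.continuousAt_symm hu).preimage_mem_nhds (ψ.open_source.mem_nhds hu')]
        with w hw using ψ.left_inv hw
    rw [h2.mfderiv_eq, mfderiv_eq_fderiv (f := ψ ∘ φ.symm)] at h1
    exact h1
  rw [gramMatrix_eq_formGram, gramMatrix_eq_formGram, hAB, ψ.left_inv hu', formGram_comp_det]

variable [MeasurableSpace S] [BorelSpace S]

theorem aemeasurable_chart_symm (φ : OpenPartialHomeomorph S (EuclideanSpace ℝ (Fin d)))
    {μ : Measure (EuclideanSpace ℝ (Fin d))} (h : μ ≪ volume.restrict φ.target) :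
    AEMeasurable φ.symm μ :=
  (φ.continuousOn_symm.aemeasurable φ.open_target.measurableSet).mono_ac h

theorem measurableSet_chart_preimage (φ : OpenPartialHomeomorph S (EuclideanSpace ℝ (Fin d)))
    {B : Set S} (hB : MeasurableSet B) : MeasurableSet (inChart φ B) := by
  have h : Measurable (φ.target.domRestrict φ.symm) := φ.continuousOn_symm.domRestrict.measurable
  have h2 := φ.open_target.measurableSet.subtype_image (h hB)
  convert h2 using 1
  ext u
  simp [inChart, Set.domRestrict, and_comm]

theorem chartVolume_apply (φ : OpenPartialHomeomorph S (EuclideanSpace ℝ (Fin d)))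
    {B : Set S} (hB : MeasurableSet B) :
    chartVolume g φ B =
      ∫⁻ u in inChart φ B, ENNReal.ofReal (Real.sqrt (gramMatrix g φ u).det) := by
  have hm : AEMeasurable φ.symm (((volume.restrict φ.target).withDensity
      fun u => ENNReal.ofReal (Real.sqrt (gramMatrix g φ u).det))) :=
    aemeasurable_chart_symm φ (withDensity_absolutelyContinuous _ _)
  have hn : NullMeasurableSet (φ.symm ⁻¹' B) (volume.restrict φ.target) :=
    (aemeasurable_chart_symm φ Measure.AbsolutelyContinuous.rfl).nullMeasurableSet_preimage hB
  rw [chartVolume, Measure.map_apply_of_aemeasurable hm hB, withDensity_apply₀ _ hn,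
    Measure.restrict_restrict₀ hn, Set.inter_comm]
  rfl

/-- Change of variables: the Jacobian |det J| of the transition map is exactly the ratio of the two
densities, because the Gram determinants differ by the factor (det J)². -/
theorem chartVolume_eq_of_subset (hφ : φ ∈ IsManifold.maximalAtlas (𝓡 d) ∞ S)
    (hψ : ψ ∈ IsManifold.maximalAtlas (𝓡 d) ∞ S) {B : Set S} (hB : MeasurableSet B)
    (hBφ : B ⊆ φ.source) (hBψ : B ⊆ ψ.source) : chartVolume g φ B = chartVolume g ψ B := by
  rw [chartVolume_apply g φ hB, chartVolume_apply g ψ hB]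
  have himg : inChart ψ B = (ψ ∘ φ.symm) '' inChart φ B := by
    ext v
    constructor
    · rintro ⟨hv, hvB⟩
      refine ⟨φ (ψ.symm v), ⟨φ.map_source (hBφ hvB), ?_⟩, ?_⟩
      · simpa [φ.left_inv (hBφ hvB)] using hvB
      · simp [φ.left_inv (hBφ hvB), ψ.right_inv hv]
    · rintro ⟨u, ⟨hu, huB⟩, rfl⟩
      refine ⟨ψ.map_source (hBψ huB), ?_⟩
      have : ψ.symm (ψ (φ.symm u)) = φ.symm u := ψ.left_inv (hBψ huB)
      simpa [this] using huB
  have hinj : Set.InjOn (ψ ∘ φ.symm) (inChart φ B) := by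
    rintro u ⟨hu, huB⟩ v ⟨hv, hvB⟩ h
    exact φ.symm.injOn hu hv (ψ.injOn (hBψ huB) (hBψ hvB) h)
  rw [himg, lintegral_image_eq_lintegral_abs_det_fderiv_mul volume
    (measurableSet_chart_preimage φ hB)
    (fun u hu => (gramMatrix_det_change g hφ hψ hu.1
      (hBψ hu.2)).1.hasFDerivAt.hasFDerivWithinAt) hinj]
  refine setLIntegral_congr_fun (measurableSet_chart_preimage φ hB) fun u hu => ?_
  have h := (gramMatrix_det_change g hφ hψ hu.1 (hBψ hu.2)).2
  simp only [Function.comp_apply]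
  rw [h, Real.sqrt_mul (sq_nonneg _), Real.sqrt_sq_eq_abs, ENNReal.ofReal_mul (abs_nonneg _)]

/-- On the domain of a smooth chart the Riemannian volume is given by the usual formula. -/
theorem riemannianVolume_eq_chartVolume (hφ : φ ∈ IsManifold.maximalAtlas (𝓡 d) ∞ S)
    {B : Set S} (hB : MeasurableSet B) (hBφ : B ⊆ φ.source) :
    riemannianVolume g B = chartVolume g φ B := by
  refine le_antisymm ?_ ?_
  -- A supremum of measures is not evaluated setwise, so all chart volumes are bounded by a single
  -- measure: the volume of the chart φ, plus infinite mass at every point outside its domain. The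
  -- extra term vanishes on B.
  · have hle : riemannianVolume g ≤
        chartVolume g φ + (⊤ : ℝ≥0∞) • Measure.count.restrict φ.sourceᶜ := by
      refine iSup₂_le fun ψ hψ => Measure.le_iff.2 fun A hA => ?_
      have hs := φ.open_source.measurableSet
      rw [← measure_inter_add_sdiff A hs]
      refine add_le_add ?_ ?_ |>.trans (Measure.add_apply _ _ A).ge
      -- The volume of the chart ψ charges only the domain of ψ, which reduces this to the overlap.
      · have h1 : chartVolume g ψ (A ∩ φ.source) =
            chartVolume g ψ (A ∩ φ.source ∩ ψ.source) := by
          rw [chartVolume_apply g ψ (hA.inter hs),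
            chartVolume_apply g ψ ((hA.inter hs).inter ψ.open_source.measurableSet)]
          congr 2
          ext u
          exact ⟨fun h => ⟨h.1, h.2, ψ.map_target h.1⟩, fun h => ⟨h.1, h.2.1⟩⟩
        rw [h1, ← chartVolume_eq_of_subset g hφ hψ
          ((hA.inter hs).inter ψ.open_source.measurableSet)
          (fun x hx => hx.1.2) (fun x hx => hx.2)]
        exact measure_mono fun x hx => hx.1.1
      · rw [Measure.smul_apply, Measure.restrict_apply hA, smul_eq_mul]
        rcases (A \ φ.source).eq_empty_or_nonempty with h0 | h0
        · simp [h0]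
        · have : Measure.count (A ∩ φ.sourceᶜ) ≠ 0 := by
            rw [Ne, Measure.count_eq_zero_iff]
            exact h0.ne_empty
          rw [ENNReal.top_mul this]
          exact le_top
    refine (hle B).trans ?_
    rw [Measure.add_apply, Measure.smul_apply, Measure.restrict_apply hB]
    have : B ∩ φ.sourceᶜ = ∅ := by
      rw [← Set.sdiff_eq, Set.sdiff_eq_empty]; exact hBφ
    simp [this]
  · exact (le_iSup₂ (f := fun ψ (_ : ψ ∈ IsManifold.maximalAtlas (𝓡 d) ∞ S) =>
      chartVolume g ψ) φ hφ : chartVolume g φ ≤ riemannianVolume g) B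

end Riemannian

/-! ### Lebesgue measure of a chart versus Riemannian volume -/

section ChartLebesgue

variable {d : ℕ} {S : Type*} [TopologicalSpace S] [ChartedSpace (EuclideanSpace ℝ (Fin d)) S]
  [IsManifold (𝓡 d) ∞ S] (g : SmoothMetric d S)
  {φ : OpenPartialHomeomorph S (EuclideanSpace ℝ (Fin d))}
  [MeasurableSpace S] [BorelSpace S]

/-- The image on `S` of the Lebesgue measure on `Φ⁻¹(A)`, where `Φ = φ⁻¹`. -/
def chartLebesgue (φ : OpenPartialHomeomorph S (EuclideanSpace ℝ (Fin d))) (A : Set S) :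
    Measure S :=
  (volume.restrict (inChart φ A)).map φ.symm

/-- Off `φ.target` the values of `φ.symm` carry no meaning, so the preimage of B and `inChart φ B`
agree only almost everywhere. Null measurability is the right generality because the pieces of a
decomposition are only null measurable. -/
theorem chartLebesgue_apply (φ : OpenPartialHomeomorph S (EuclideanSpace ℝ (Fin d)))
    (A : Set S) {B : Set S} (hB : NullMeasurableSet B (chartLebesgue φ A)) :
    chartLebesgue φ A B = volume.restrict (inChart φ A) (inChart φ B) := by
  have hac : volume.restrict (inChart φ A) ≪ volume.restrict φ.target :=
    Measure.absolutelyContinuous_of_le (Measure.restrict_mono_set _ Set.inter_subset_left)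
  rw [chartLebesgue, Measure.map_apply₀ (aemeasurable_chart_symm φ hac) hB]
  refine measure_congr ?_
  have h : ∀ᵐ u ∂volume.restrict (inChart φ A), u ∈ φ.target :=
    hac.ae_le (ae_restrict_mem φ.open_target.measurableSet)
  filter_upwards [h] with u hu
  exact propext ⟨fun h => ⟨hu, h⟩, fun h => h.2⟩

theorem image_inChart {A : Set S} (hA : A ⊆ φ.source) : φ.symm '' inChart φ A = A := by
  ext x
  constructor
  · rintro ⟨u, hu, rfl⟩
    exact hu.2
  · intro hx
    exact ⟨φ x, ⟨φ.map_source (hA hx), by simpa [φ.left_inv (hA hx)] using hx⟩,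
      φ.left_inv (hA hx)⟩

theorem isOpen_of_isOpen_inChart {A : Set S} (hA : A ⊆ φ.source) (h : IsOpen (inChart φ A)) :
    IsOpen A := by
  rw [← image_inChart hA]
  exact φ.symm.isOpen_image_of_subset_source h Set.inter_subset_left

/-- On a set whose compact closure lies in a chart domain, the Riemannian volume is comparable to
the Lebesgue measure of the chart. -/
theorem exists_chartLebesgue_comparison [T2Space S]
    (hφ : φ ∈ IsManifold.maximalAtlas (𝓡 d) ∞ S) {A : Set S} (hA : MeasurableSet A)
    (hcl : closure A ⊆ φ.source) (hc : IsCompact (closure A)) :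
    ∃ c C : ℝ≥0∞, c ≠ ⊤ ∧ C ≠ ⊤ ∧ chartLebesgue φ A ≤ c • (riemannianVolume g).restrict A ∧
      (riemannianVolume g).restrict A ≤ C • chartLebesgue φ A := by
  set ρ : EuclideanSpace ℝ (Fin d) → ℝ := fun u => Real.sqrt (gramMatrix g φ u).det with hρ
  -- The density is estimated on the compact image of the closure, where continuity and positivity
  -- give uniform bounds from both sides.
  set K := φ '' closure A with hK
  have hKc : IsCompact K := hc.image_of_continuousOn (φ.continuousOn.mono hcl)
  have hKt : K ⊆ φ.target := by
    rintro _ ⟨x, hx, rfl⟩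
    exact φ.map_source (hcl hx)
  have hρc : ContinuousOn ρ K := by
    refine ContinuousOn.mono ?_ hKt
    exact (Continuous.matrix_det continuous_id).comp_continuousOn
      (continuousOn_gramMatrix g hφ) |>.sqrt
  have hρpos : ∀ u ∈ K, 0 < ρ u := fun u hu =>
    Real.sqrt_pos.2 (gramMatrix_det_pos g hφ (hKt hu))
  obtain ⟨a, ha, hab⟩ : ∃ a : ℝ, 0 < a ∧ ∀ u ∈ K, a ≤ ρ u := by
    rcases K.eq_empty_or_nonempty with h | h
    · exact ⟨1, one_pos, by simp [h]⟩
    · obtain ⟨u, hu, hmin⟩ := hKc.exists_isMinOn h hρc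
      exact ⟨ρ u, hρpos u hu, fun v hv => hmin hv⟩
  obtain ⟨b, hb⟩ := hKc.bddAbove_image hρc
  have hsub : inChart φ A ⊆ K := fun u hu =>
    ⟨φ.symm u, subset_closure hu.2, φ.right_inv hu.1⟩
  have key : ∀ B : Set S, MeasurableSet B → (riemannianVolume g).restrict A B =
      ∫⁻ u in inChart φ (B ∩ A), ENNReal.ofReal (ρ u) := fun B hB => by
    rw [Measure.restrict_apply hB, riemannianVolume_eq_chartVolume g hφ (hB.inter hA)
      fun x hx => hcl (subset_closure hx.2), chartVolume_apply g φ (hB.inter hA)]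
  have key2 : ∀ B : Set S, MeasurableSet B → chartLebesgue φ A B =
      volume (inChart φ (B ∩ A)) := fun B hB => by
    rw [chartLebesgue_apply φ A hB.nullMeasurableSet,
      Measure.restrict_apply (measurableSet_chart_preimage φ hB)]
    congr 1
    ext u
    exact ⟨fun h => ⟨h.1.1, h.1.2, h.2.2⟩, fun h => ⟨⟨h.1, h.2.1⟩, h.1, h.2.2⟩⟩
  refine ⟨(ENNReal.ofReal a)⁻¹, ENNReal.ofReal b, by simpa using ha, ENNReal.ofReal_ne_top,
    Measure.le_iff.2 fun B hB => ?_, Measure.le_iff.2 fun B hB => ?_⟩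
  · rw [Measure.smul_apply, key B hB, key2 B hB, smul_eq_mul,
      ← ENNReal.mul_le_iff_le_inv (by simpa using ha) ENNReal.ofReal_ne_top, ← setLIntegral_const]
    exact setLIntegral_mono' (measurableSet_chart_preimage φ (hB.inter hA)) fun u hu =>
      ENNReal.ofReal_le_ofReal (hab u (hsub ⟨hu.1, hu.2.2⟩))
  · rw [key B hB, Measure.smul_apply, key2 B hB, smul_eq_mul, ← setLIntegral_const]
    exact setLIntegral_mono' (measurableSet_chart_preimage φ (hB.inter hA)) fun u hu =>
      ENNReal.ofReal_le_ofReal (hb ⟨u, hsub ⟨hu.1, hu.2.2⟩, rfl⟩)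

end ChartLebesgue

/-! ### Orthogonality of roots of unity -/

section RootsOfUnity

/-- The primitive root of unity `exp (2 π i / p)`. -/
def unitRoot (p : ℕ) : ℂ := Complex.exp (2 * Real.pi * Complex.I / p)

theorem isPrimitiveRoot_unitRoot (p : ℕ) [p.AtLeastTwo] : IsPrimitiveRoot (unitRoot p) p :=
  Complex.isPrimitiveRoot_exp p (NeZero.ne p)

theorem sum_unitRoot_pow {p : ℕ} [p.AtLeastTwo] (m : ℤ) (hm : ¬ (p : ℤ) ∣ m) :
    ∑ j ∈ Finset.range p, (unitRoot p ^ m) ^ j = 0 := by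
  have h1 : unitRoot p ^ m ≠ 1 := fun h =>
    hm (((isPrimitiveRoot_unitRoot p).zpow_eq_one_iff_dvd m).1 h)
  have h2 : (unitRoot p ^ m) ^ p = 1 := by
    rw [← zpow_natCast, ← zpow_mul, mul_comm, zpow_mul, zpow_natCast,
      (isPrimitiveRoot_unitRoot p).pow_eq_one, one_zpow]
  rw [geom_sum_eq h1, h2, sub_self, zero_div]

/-- Used twice: with j running over the children it gives orthogonality of the Haar vectors, with j
in the role of the frequency it gives Fourier inversion. -/
theorem sum_unitRoot_pow_ite {p : ℕ} [p.AtLeastTwo] {a b : ℕ} (ha : a < p) (hb : b < p) :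
    ∑ j ∈ Finset.range p, (unitRoot p ^ ((b : ℤ) - a)) ^ j = if a = b then (p : ℂ) else 0 := by
  split_ifs with h
  · simp [h]
  · refine sum_unitRoot_pow _ fun hd => h ?_
    have := Int.eq_zero_of_abs_lt_dvd hd (by rw [abs_lt]; constructor <;> omega)
    omega

theorem conj_unitRoot {p : ℕ} [p.AtLeastTwo] : (starRingEnd ℂ) (unitRoot p) = (unitRoot p)⁻¹ := by
  have h : ‖unitRoot p‖ = 1 := (isPrimitiveRoot_unitRoot p).norm'_eq_one (NeZero.ne p)
  rw [Complex.inv_def, Complex.normSq_eq_norm_sq, h]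
  simp

end RootsOfUnity

/-! ### Haar-type systems on the p-ary tree in an inner product space -/

section TreeSystem

variable {H : Type*} [NormedAddCommGroup H] [InnerProductSpace ℂ H] {p : ℕ}

/-- The Haar type vectors `p ^ (n / 2) ∑ⱼ θ ^ j e (n + 1) (p k + j)` attached to a family `e n k`. -/
def treeVec (p : ℕ) (e : ℕ → ℕ → H) : TreeIndex p → H
  | .rad => e 0 0
  | .node n k t => (((p : ℝ) ^ ((n : ℝ) / 2) : ℝ) : ℂ) • ∑ j ∈ Finset.range p,
      (unitRoot p ^ ((t : ℕ) + 1)) ^ j • e (n + 1) (p * (k : ℕ) + j)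

/-- The span of the vectors of generation `n`. -/
def treeSpan (p : ℕ) (e : ℕ → ℕ → H) (n : ℕ) : Submodule ℂ H :=
  Submodule.span ℂ (Set.range fun k : Fin (p ^ n) => e n k)

/-- Every vector is the sum of its `p` children. -/
def IsRefinable (p : ℕ) (e : ℕ → ℕ → H) : Prop :=
  ∀ n k, k < p ^ n → e n k = ∑ j ∈ Finset.range p, e (n + 1) (p * k + j)

variable {e : ℕ → ℕ → H}

theorem child_lt {n k j : ℕ} (hk : k < p ^ n) (hj : j < p) : p * k + j < p ^ (n + 1) := by
  rw [pow_succ]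
  nlinarith

theorem mem_treeSpan {n k : ℕ} (hk : k < p ^ n) : e n k ∈ treeSpan p e n :=
  Submodule.subset_span ⟨⟨k, hk⟩, rfl⟩

theorem treeSpan_mono (he : IsRefinable p e) : Monotone (treeSpan p e) := by
  refine monotone_nat_of_le_succ fun n => Submodule.span_le.2 ?_
  rintro _ ⟨k, rfl⟩
  simp only [SetLike.mem_coe]
  rw [he n k k.2]
  exact Submodule.sum_mem _ fun j hj => mem_treeSpan (child_lt k.2 (Finset.mem_range.1 hj))

theorem treeVec_mem_treeSpan (he : IsRefinable p e) {z : TreeIndex p} {n : ℕ} (hz : z.gen < n) :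
    treeVec p e z ∈ treeSpan p e n := by
  cases z with
  | rad => exact treeSpan_mono he (Nat.zero_le n) (mem_treeSpan (by simp))
  | node m k t =>
    have hm : m + 1 ≤ n := by simp only [TreeIndex.gen] at hz; omega
    refine treeSpan_mono he hm (Submodule.smul_mem _ _ (Submodule.sum_mem _ fun j hj =>
      Submodule.smul_mem _ _ (mem_treeSpan (child_lt k.2 (Finset.mem_range.1 hj)))))

/-- Induction on n. For a fixed parent, the zeroth Fourier sum over its children is the parent
itself, and the other p - 1 sums are multiples of tree vectors of generation n. Inverting the
discrete Fourier transform recovers each child. The generation -1 of the root makes the case n = 0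
fit. -/
theorem treeSpan_eq_span_treeVec [p.AtLeastTwo] (he : IsRefinable p e) (n : ℕ) :
    treeSpan p e n = Submodule.span ℂ (treeVec p e '' {z | z.gen < n}) := by
  refine le_antisymm ?_ (Submodule.span_le.2 ?_)
  · induction n with
    | zero =>
      refine Submodule.span_le.2 ?_
      rintro _ ⟨k, rfl⟩
      have hk : (k : ℕ) = 0 := by have := k.2; simp only [pow_zero] at this; omega
      refine Submodule.subset_span ⟨.rad, by simp [TreeIndex.gen], ?_⟩
      simp [treeVec, hk]
    | succ n ih =>
      set W := Submodule.span ℂ (treeVec p e '' {z | z.gen < ((n + 1 : ℕ) : ℤ)}) with hW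
      have hp : (p : ℂ) ≠ 0 := Nat.cast_ne_zero.2 (NeZero.ne p)
      have ih' : treeSpan p e n ≤ W := ih.trans (Submodule.span_mono (Set.image_mono fun z hz => by
        simp only [Set.mem_ofPred_eq] at hz ⊢; push_cast; omega))
      refine Submodule.span_le.2 ?_
      rintro _ ⟨k', rfl⟩
      obtain ⟨k, i, hk, hi, hki⟩ : ∃ k i, k < p ^ n ∧ i < p ∧ (k' : ℕ) = p * k + i := by
        refine ⟨k' / p, k' % p, Nat.div_lt_of_lt_mul ?_, Nat.mod_lt _ (NeZero.pos p),
          (Nat.div_add_mod _ _).symm⟩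
        exact k'.2.trans_eq (by ring)
      simp only [SetLike.mem_coe, hki]
      have hmem : ∀ σ < p, ∑ j ∈ Finset.range p, (unitRoot p ^ σ) ^ j • e (n + 1) (p * k + j)
          ∈ W := by
        intro σ hσ
        rcases Nat.eq_zero_or_pos σ with rfl | h0
        · simp only [pow_zero, one_pow, one_smul]
          rw [← he n k hk]
          exact ih' (mem_treeSpan hk)
        · have hpos : (((p : ℝ) ^ ((n : ℝ) / 2) : ℝ) : ℂ) ≠ 0 := by
            exact_mod_cast (Real.rpow_pos_of_pos (Nat.cast_pos.2 (NeZero.pos p)) _).ne'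
          have h := Submodule.subset_span (R := ℂ)
            (s := treeVec p e '' {z | z.gen < ((n + 1 : ℕ) : ℤ)})
            -- The index of a node is the frequency shifted by one, since frequency 0 is excluded.
            ⟨TreeIndex.node n ⟨k, hk⟩ ⟨σ - 1, by omega⟩, by simp [TreeIndex.gen], rfl⟩
          have h2 := (Submodule.smul_mem_iff _ hpos).1 h
          simpa only [Nat.sub_add_cancel h0] using h2
      -- Inverse discrete Fourier transform on the children of k.
      have hinv : (p : ℂ) • e (n + 1) (p * k + i) = ∑ σ ∈ Finset.range p,
          ((unitRoot p)⁻¹ ^ i) ^ σ •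
            ∑ j ∈ Finset.range p, (unitRoot p ^ σ) ^ j • e (n + 1) (p * k + j) := by
        simp only [Finset.smul_sum, smul_smul]
        rw [Finset.sum_comm]
        have : ∀ j ∈ Finset.range p, ∑ σ ∈ Finset.range p,
            (((unitRoot p)⁻¹ ^ i) ^ σ * (unitRoot p ^ σ) ^ j) • e (n + 1) (p * k + j) =
            (if i = j then (p : ℂ) else 0) • e (n + 1) (p * k + j) := by
          intro j hj
          rw [← Finset.sum_smul, ← sum_unitRoot_pow_ite hi (Finset.mem_range.1 hj)]
          congr 1
          refine Finset.sum_congr rfl fun σ _ => ?_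
          have h0 : unitRoot p ≠ 0 := (isPrimitiveRoot_unitRoot p).ne_zero (NeZero.ne p)
          rw [zpow_sub₀ h0, zpow_natCast, zpow_natCast, div_pow, inv_pow, inv_pow, ← pow_mul,
            ← pow_mul, ← pow_mul, mul_comm j σ, div_eq_inv_mul]
        rw [Finset.sum_congr rfl this]
        simp [ite_smul, hi]
      refine (Submodule.smul_mem_iff _ hp).1 ?_
      rw [hinv]
      exact Submodule.sum_mem _ fun σ hσ =>
        Submodule.smul_mem _ _ (hmem σ (Finset.mem_range.1 hσ))
  · rintro _ ⟨z, hz, rfl⟩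
    exact treeVec_mem_treeSpan he hz

/-- The vectors of each generation are orthogonal with norm `p ^ (-n / 2)`. -/
def IsBalancedSystem (p : ℕ) (e : ℕ → ℕ → H) : Prop :=
  ∀ n k l, k < p ^ n → l < p ^ n →
    inner ℂ (e n k) (e n l) = if k = l then ((p : ℂ) ^ n)⁻¹ else 0

/-- Division with remainder by p shows that distinct pairs of parent and position are distinct
children. Inner products within a generation thus reduce to those of coefficient vectors in ℂ^p. -/
theorem inner_children [p.AtLeastTwo] (hb : IsBalancedSystem p e) {n k l : ℕ} (hk : k < p ^ n)
    (hl : l < p ^ n) (a b : ℕ → ℂ) :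
    inner ℂ (∑ j ∈ Finset.range p, a j • e (n + 1) (p * k + j))
      (∑ j ∈ Finset.range p, b j • e (n + 1) (p * l + j)) =
    if k = l then ((p : ℂ) ^ (n + 1))⁻¹ * ∑ j ∈ Finset.range p, (starRingEnd ℂ) (a j) * b j
      else 0 := by
  simp only [sum_inner, inner_sum, inner_smul_left, inner_smul_right]
  have h : ∀ i ∈ Finset.range p, ∀ j ∈ Finset.range p,
      inner ℂ (e (n + 1) (p * k + i)) (e (n + 1) (p * l + j)) =
        if k = l ∧ i = j then ((p : ℂ) ^ (n + 1))⁻¹ else 0 := by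
    intro i hi j hj
    rw [Finset.mem_range] at hi hj
    rw [hb _ _ _ (child_lt hk hi) (child_lt hl hj)]
    congr 1
    refine propext ⟨fun h => ?_, fun h => by rw [h.1, h.2]⟩
    have h1 := congrArg (· / p) h
    have h2 := congrArg (· % p) h
    simp only [Nat.mul_add_div (NeZero.pos p), Nat.div_eq_of_lt hi, Nat.div_eq_of_lt hj,
      add_zero, Nat.mul_add_mod, Nat.mod_eq_of_lt hi, Nat.mod_eq_of_lt hj] at h1 h2
    exact ⟨h1, h2⟩
  by_cases hkl : k = l
  · rw [if_pos hkl, Finset.mul_sum]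
    refine Finset.sum_congr rfl fun j hj => ?_
    rw [Finset.sum_eq_single_of_mem j hj fun i hi hij => by
      rw [h i hi j hj, if_neg fun h' => hij h'.2, mul_zero], h j hj j hj, if_pos ⟨hkl, rfl⟩]
    ring
  · rw [if_neg hkl]
    refine Finset.sum_eq_zero fun j hj => ?_
    rw [Finset.sum_eq_zero fun i hi => by
      rw [h i hi j hj, if_neg fun h' => hkl h'.1, mul_zero], mul_zero]

/-- An element of a coarser span has equal coefficients on all children of a node, while the
coefficients of a tree vector there are powers of a nontrivial p-th root of unity and sum to zero.
-/
theorem inner_treeSpan_treeVec [p.AtLeastTwo] (he : IsRefinable p e) (hb : IsBalancedSystem p e)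
    {z : TreeIndex p} {n : ℕ} (hz : (n : ℤ) ≤ z.gen) {x : H} (hx : x ∈ treeSpan p e n) :
    inner ℂ x (treeVec p e z) = 0 := by
  cases z with
  | rad => simp only [TreeIndex.gen] at hz; omega
  | node m k t =>
    replace hx : x ∈ treeSpan p e m := treeSpan_mono he (by simpa [TreeIndex.gen] using hz) hx
    induction hx using Submodule.span_induction with
    | mem y hy =>
      obtain ⟨l, rfl⟩ := hy
      have h1 : e m l = ∑ j ∈ Finset.range p, (1 : ℂ) • e (m + 1) (p * l + j) := by
        simpa using he m l l.2
      -- The frequency t + 1 lies between 1 and p - 1, so p does not divide it.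
      have h2 := sum_unitRoot_pow (p := p) ((t : ℕ) + 1 : ℕ) (fun h => by
        have := Nat.le_of_dvd (by omega) (Int.natCast_dvd_natCast.1 h)
        have := t.2
        omega)
      simp only [zpow_natCast] at h2
      simp only [treeVec, inner_smul_right]
      rw [h1, inner_children hb l.2 k.2 (fun _ => 1)]
      simp [h2]
    | zero => simp
    | add y w _ _ hy hw => rw [inner_add_left, hy, hw, add_zero]
    | smul a y _ hy => rw [inner_smul_left, hy, mul_zero]

/-- Across generations, the coarser vector lies in the span to which the finer one is orthogonal.
Within a generation, nodes decouple and the roots of unity separate the frequencies. The norm is p^n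
· p^(-(n+1)) · p = 1. -/
theorem orthonormal_treeVec [p.AtLeastTwo] (he : IsRefinable p e) (hb : IsBalancedSystem p e) :
    Orthonormal ℂ (treeVec p e) := by
  classical
  rw [orthonormal_iff_ite]
  have hlt : ∀ z w : TreeIndex p, z.gen < w.gen → inner ℂ (treeVec p e z) (treeVec p e w) = 0 := by
    intro z w h
    cases w with
    | rad => cases z <;> simp only [TreeIndex.gen] at h <;> omega
    | node m k t => exact inner_treeSpan_treeVec he hb le_rfl (treeVec_mem_treeSpan he h)
  intro z w
  rcases lt_trichotomy z.gen w.gen with h | h | h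
  · rw [hlt z w h, if_neg fun h' => by simp [h'] at h]
  · cases z with
    | rad =>
      cases w with
      | rad => simpa [treeVec] using hb 0 0 0 (by simp) (by simp)
      | node m k t => simp only [TreeIndex.gen] at h; omega
    | node n k t =>
      cases w with
      | rad => simp only [TreeIndex.gen] at h; omega
      | node m l u =>
        obtain rfl : n = m := by simpa [TreeIndex.gen] using h
        simp only [treeVec, inner_smul_left, inner_smul_right, Complex.conj_ofReal]
        rw [inner_children hb k.2 l.2]
        have hp : (0 : ℝ) < p := Nat.cast_pos.2 (NeZero.pos p)
        have h0 : unitRoot p ≠ 0 := (isPrimitiveRoot_unitRoot p).ne_zero (NeZero.ne p)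
        have hsum : ∑ j ∈ Finset.range p, (starRingEnd ℂ) ((unitRoot p ^ ((t : ℕ) + 1)) ^ j) *
            (unitRoot p ^ ((u : ℕ) + 1)) ^ j = if t = u then (p : ℂ) else 0 := by
          have h1 := sum_unitRoot_pow_ite (p := p) (a := t + 1) (b := u + 1) (by omega) (by omega)
          simp only [add_left_inj, Fin.val_inj] at h1
          rw [← h1]
          refine Finset.sum_congr rfl fun j _ => ?_
          rw [map_pow, map_pow, conj_unitRoot, zpow_sub₀ h0, zpow_natCast, zpow_natCast, div_pow,
            inv_pow, inv_pow]
          field_simp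
        rw [hsum]
        have hsq : (((p : ℝ) ^ ((n : ℝ) / 2) : ℝ) : ℂ) * (((p : ℝ) ^ ((n : ℝ) / 2) : ℝ) : ℂ) =
            (p : ℂ) ^ n := by
          rw [← Complex.ofReal_mul, ← Real.rpow_add hp, add_halves, Real.rpow_natCast]
          simp
        have hpc : (p : ℂ) ≠ 0 := Nat.cast_ne_zero.2 (NeZero.ne p)
        by_cases hk : k = l <;> by_cases ht : t = u
        · simp only [hk, ht, if_true]
          rw [← mul_assoc, ← mul_assoc, hsq, pow_succ]
          field_simp
        · simp [hk, ht]
        · simp [hk, ht, Fin.val_inj]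
        · simp [hk, ht, Fin.val_inj]
  · rw [← inner_conj_symm, hlt w z h, map_zero, if_neg fun h' => by simp [h'] at h]

end TreeSystem

/-! ### Indicator functions in L² of a finite measure -/

section IndicatorL2

variable {X : Type*} [MeasurableSpace X] {μ : Measure X} [IsFiniteMeasure μ] {A B : Set X}

theorem memLp_indicator_one (hA : NullMeasurableSet A μ) :
    MemLp (A.indicator fun _ => (1 : ℂ)) 2 μ := by
  refine MemLp.of_bound (aestronglyMeasurable_const.indicator₀ hA) 1 (ae_of_all _ fun x => ?_)
  by_cases hx : x ∈ A <;> simp [hx]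

theorem indicatorL2_coeFn (hA : NullMeasurableSet A μ) :
    indicatorL2 μ A =ᵐ[μ] A.indicator fun _ => (1 : ℂ) := by
  rw [indicatorL2, dif_pos (memLp_indicator_one hA)]
  exact MemLp.coeFn_toLp _

theorem inner_indicatorL2 (hA : NullMeasurableSet A μ) (f : Lp ℂ 2 μ) :
    inner ℂ (indicatorL2 μ A) f = ∫ x in A, f x ∂μ := by
  rw [L2.inner_def, ← integral_indicator₀ hA]
  refine integral_congr_ae ?_
  filter_upwards [indicatorL2_coeFn hA] with x hx
  rw [hx]
  by_cases h : x ∈ A <;> simp [h]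

theorem inner_indicatorL2_indicatorL2 (hA : NullMeasurableSet A μ) (hB : NullMeasurableSet B μ) :
    inner ℂ (indicatorL2 μ A) (indicatorL2 μ B) = (μ.real (A ∩ B) : ℂ) := by
  rw [inner_indicatorL2 hA, integral_congr_ae (ae_restrict_of_ae (indicatorL2_coeFn hB)),
    integral_indicator₀ (hB.mono_ac Measure.restrict_le_self.absolutelyContinuous),
    Measure.restrict_restrict₀ (hB.mono_ac Measure.restrict_le_self.absolutelyContinuous),
    Set.inter_comm]
  simp

end IndicatorL2

/-! ### Multiscale decompositions: refinement, balance and density -/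

namespace IsMultiscaleDecomposition

variable {X : Type*} [MeasurableSpace X] {μ ν : Measure X} {p : ℕ} {Ω : Set X}
  {D : ℕ → ℕ → Set X}

/-- The measure enters only through its null sets, so the decomposition can be carried over to the
balanced measure. -/
theorem mono_ac (h : IsMultiscaleDecomposition μ p Ω D) (hν : ν ≪ μ) :
    IsMultiscaleDecomposition ν p Ω D where
  measurable n k hk := (h.measurable n k hk).mono_ac hν
  nonempty := h.nonempty
  subset := h.subset
  root := h.root
  disjoint := h.disjoint
  child_subset := h.child_subset
  exhaust n k hk := hν (h.exhaust n k hk)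

theorem disjoint_children (h : IsMultiscaleDecomposition μ p Ω D) {n k i j : ℕ} (hk : k < p ^ n)
    (hi : i < p) (hj : j < p) (hij : i ≠ j) :
    Disjoint (D (n + 1) (p * k + i)) (D (n + 1) (p * k + j)) :=
  h.disjoint _ _ _ (child_lt hk hi) (child_lt hk hj) (by omega)

theorem ae_mem_child (h : IsMultiscaleDecomposition μ p Ω D) {n k : ℕ} (hk : k < p ^ n) :
    ∀ᵐ x ∂μ, x ∈ D n k → ∃ j < p, x ∈ D (n + 1) (p * k + j) := by
  filter_upwards [measure_eq_zero_iff_ae_notMem.1 (h.exhaust n k hk)] with x hx hxk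
  by_contra hcon
  refine hx ⟨hxk, fun hmem => hcon ?_⟩
  simpa using hmem

theorem ae_mem_generation (h : IsMultiscaleDecomposition μ p Ω D) (n : ℕ) :
    ∀ᵐ x ∂μ, x ∈ Ω → ∃ k < p ^ n, x ∈ D n k := by
  induction n with
  | zero => exact ae_of_all _ fun x hx => ⟨0, by simp, by rwa [h.root]⟩
  | succ n ih =>
    have : ∀ᵐ x ∂μ, ∀ k, k < p ^ n → x ∈ D n k → ∃ j < p, x ∈ D (n + 1) (p * k + j) :=
      ae_all_iff.2 fun k => by
        by_cases hk : k < p ^ n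
        · filter_upwards [h.ae_mem_child hk] with x hx _ using hx
        · exact ae_of_all _ fun x hk' => absurd hk' hk
    filter_upwards [ih, this] with x hx hx' hxΩ
    obtain ⟨k, hk, hxk⟩ := hx hxΩ
    obtain ⟨j, hj, hxj⟩ := hx' k hk hxk
    exact ⟨_, child_lt hk hj, hxj⟩

theorem isRefinable [IsFiniteMeasure μ] (h : IsMultiscaleDecomposition μ p Ω D) :
    IsRefinable p fun n k => indicatorL2 μ (D n k) := by
  intro n k hk
  refine Lp.ext ?_
  have h1 : ∀ᵐ x ∂μ, ∀ j, j < p → indicatorL2 μ (D (n + 1) (p * k + j)) x =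
      (D (n + 1) (p * k + j)).indicator (fun _ => (1 : ℂ)) x :=
    ae_all_iff.2 fun j => by
      by_cases hj : j < p
      · filter_upwards [indicatorL2_coeFn (h.measurable _ _ (child_lt hk hj))] with x hx _ using hx
      · exact ae_of_all _ fun x hj' => absurd hj' hj
  filter_upwards [indicatorL2_coeFn (h.measurable n k hk), h1, h.ae_mem_child hk,
    Lp.coeFn_fun_finsetSum (Finset.range p) fun j => indicatorL2 μ (D (n + 1) (p * k + j))]
    with x hx hx1 hx2 hx3
  rw [hx, hx3, Finset.sum_congr rfl fun j hj => hx1 j (Finset.mem_range.1 hj)]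
  by_cases hxk : x ∈ D n k
  · obtain ⟨j, hj, hxj⟩ := hx2 hxk
    rw [Set.indicator_of_mem hxk, Finset.sum_eq_single_of_mem j (Finset.mem_range.2 hj),
      Set.indicator_of_mem hxj]
    intro i hi hij
    exact Set.indicator_of_notMem (fun hxi => Set.disjoint_left.1
      (h.disjoint_children hk (Finset.mem_range.1 hi) hj hij) hxi hxj) _
  · rw [Set.indicator_of_notMem hxk, Finset.sum_eq_zero]
    intro j hj
    exact Set.indicator_of_notMem (fun hxj => hxk
      (h.child_subset n k j hk (Finset.mem_range.1 hj) hxj)) _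

theorem measure_eq_sum_children (h : IsMultiscaleDecomposition μ p Ω D) {n k : ℕ}
    (hk : k < p ^ n) : μ (D n k) = ∑ j ∈ Finset.range p, μ (D (n + 1) (p * k + j)) := by
  rw [← measure_biUnion_finset₀]
  · refine measure_congr ?_
    filter_upwards [h.ae_mem_child hk] with x hx
    refine propext ⟨fun hxk => ?_, fun hxk => ?_⟩
    · obtain ⟨j, hj, hxj⟩ := hx hxk
      exact Set.mem_biUnion (Finset.mem_coe.2 (Finset.mem_range.2 hj)) hxj
    · obtain ⟨j, hj, hxj⟩ := Set.mem_iUnion₂.1 hxk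
      exact h.child_subset n k j hk (Finset.mem_range.1 hj) hxj
  · intro i hi j hj hij
    exact (h.disjoint_children hk (Finset.mem_range.1 hi) (Finset.mem_range.1 hj) hij).aedisjoint
  · exact fun j hj => h.measurable _ _ (child_lt hk (Finset.mem_range.1 hj))

/-- Descent from generation N to the root: a parent has the total mass of its p children. This
covers the generations above those described by the charts. -/
theorem measure_eq_of_eventually [p.AtLeastTwo] (h : IsMultiscaleDecomposition μ p Ω D) {N : ℕ}
    (hN : ∀ n k, N ≤ n → k < p ^ n → μ (D n k) = ((p : ℝ≥0∞) ^ n)⁻¹) :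
    ∀ n k, k < p ^ n → μ (D n k) = ((p : ℝ≥0∞) ^ n)⁻¹ := by
  have hp : (p : ℝ≥0∞) ≠ 0 := Nat.cast_ne_zero.2 (NeZero.ne p)
  -- Here m bounds the number of generations still missing up to N.
  suffices H : ∀ m n k, N ≤ n + m → k < p ^ n → μ (D n k) = ((p : ℝ≥0∞) ^ n)⁻¹ from
    fun n k hk => H N n k (by omega) hk
  intro m
  induction m with
  | zero => exact fun n k hn hk => hN n k hn hk
  | succ m ih =>
    intro n k hn hk
    rw [h.measure_eq_sum_children hk, Finset.sum_congr rfl fun j hj =>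
      ih (n + 1) _ (by omega) (child_lt hk (Finset.mem_range.1 hj))]
    rw [Finset.sum_const, Finset.card_range, nsmul_eq_mul, pow_succ,
      ENNReal.mul_inv (Or.inr (by simp)) (Or.inr hp), mul_left_comm,
      ENNReal.mul_inv_cancel hp (by simp), mul_one]

theorem isBalancedSystem [IsFiniteMeasure μ] (h : IsMultiscaleDecomposition μ p Ω D)
    (hm : ∀ n k, k < p ^ n → μ (D n k) = ((p : ℝ≥0∞) ^ n)⁻¹) :
    IsBalancedSystem p fun n k => indicatorL2 μ (D n k) := by
  intro n k l hk hl
  simp only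
  rw [inner_indicatorL2_indicatorL2 (h.measurable n k hk) (h.measurable n l hl)]
  split_ifs with hkl
  · rw [← hkl, Set.inter_self, Measure.real, hm n k hk]
    simp
  · rw [Set.disjoint_iff_inter_eq_empty.1 (h.disjoint n k l hk hl hkl)]
    simp

theorem identVec_eq_treeVec (h : IsMultiscaleDecomposition μ p Ω D) :
    identVec μ p Ω D = treeVec p fun n k => indicatorL2 μ (D n k) := by
  funext z
  cases z with
  | rad => simp [identVec, treeVec, h.root]
  | node n k t =>
    have : Complex.exp (2 * Real.pi * Complex.I / p * ((t : ℕ) + 1 : ℂ)) =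
        unitRoot p ^ ((t : ℕ) + 1) := by
      rw [unitRoot, ← Complex.exp_nat_mul]
      congr 1
      push_cast
      ring
    simp only [identVec, treeVec, this]

/-- A function f orthogonal to the span has integral zero over every piece. Up to a null set an open
set is exhausted by the pieces it contains, so dominated convergence makes the integral over every
open set vanish, hence over every closed set, and f = 0. -/
theorem dense_span [IsFiniteMeasure μ] [TopologicalSpace X] [BorelSpace X] [p.AtLeastTwo]
    (h : IsMultiscaleDecomposition μ p Ω D)
    (hs : ∀ A : Set X, IsOpen A → ∀ᵐ x ∂μ, x ∈ A →
      ∀ᶠ n in Filter.atTop, ∃ k < p ^ n, x ∈ D n k ∧ D n k ⊆ A) :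
    (Submodule.span ℂ (Set.range (identVec μ p Ω D))).topologicalClosure = ⊤ := by
  rw [Submodule.topologicalClosure_eq_top_iff, Submodule.eq_bot_iff]
  intro f hf
  have hf0 : ∀ n k, k < p ^ n → ∫ x in D n k, f x ∂μ = 0 := by
    intro n k hk
    rw [← inner_indicatorL2 (h.measurable n k hk)]
    have h1 : indicatorL2 μ (D n k) ∈ treeSpan p (fun n k => indicatorL2 μ (D n k)) n :=
      mem_treeSpan (e := fun n k => indicatorL2 μ (D n k)) hk
    rw [treeSpan_eq_span_treeVec h.isRefinable, ← h.identVec_eq_treeVec] at h1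
    exact hf _ (Submodule.span_mono (Set.image_subset_range _ _) h1)
  have hfi : Integrable f μ := (Lp.memLp f).integrable (by norm_num)
  have hopen : ∀ A : Set X, IsOpen A → ∫ x in A, f x ∂μ = 0 := by
    intro A hA
    classical
    -- The restriction of f to the pieces of generation n inside A. By disjointness its values are f
    -- or 0, so |f| dominates.
    set F : ℕ → X → ℂ := fun n x =>
      ∑ k ∈ (Finset.range (p ^ n)).filter (fun k => D n k ⊆ A), (D n k).indicator f x with hF
    have hmem : ∀ {n k}, k ∈ (Finset.range (p ^ n)).filter (fun k => D n k ⊆ A) →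
        k < p ^ n ∧ D n k ⊆ A := fun hk => by simpa using hk
    have hval : ∀ n k x, k < p ^ n → D n k ⊆ A → x ∈ D n k → F n x = f x := by
      intro n k x hk hkA hx
      simp only [hF]
      rw [Finset.sum_eq_single_of_mem k (by simp [hk, hkA]), Set.indicator_of_mem hx]
      intro l hl hlk
      exact Set.indicator_of_notMem (fun hxl =>
        Set.disjoint_left.1 (h.disjoint n l k (hmem hl).1 hk hlk) hxl hx) _
    have hval0 : ∀ n x, (∀ k, k < p ^ n → D n k ⊆ A → x ∉ D n k) → F n x = 0 := by
      intro n x hx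
      exact Finset.sum_eq_zero fun k hk =>
        Set.indicator_of_notMem (hx k (hmem hk).1 (hmem hk).2) _
    have hFm : ∀ n, ∀ k ∈ (Finset.range (p ^ n)).filter (fun k => D n k ⊆ A),
        Integrable ((D n k).indicator f) μ := fun n k hk =>
      hfi.indicator₀ (h.measurable n k (hmem hk).1)
    have hint : ∀ n, ∫ x, F n x ∂μ = 0 := by
      intro n
      rw [integral_finsetSum _ (hFm n)]
      refine Finset.sum_eq_zero fun k hk => ?_
      rw [integral_indicator₀ (h.measurable n k (hmem hk).1), hf0 n k (hmem hk).1]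
    have hlim : Filter.Tendsto (fun n => ∫ x, F n x ∂μ) Filter.atTop
        (nhds (∫ x, A.indicator f x ∂μ)) := by
      refine tendsto_integral_of_dominated_convergence (fun x => ‖f x‖)
        (fun n => (integrable_finsetSum _ (hFm n)).aestronglyMeasurable) hfi.norm
        (fun n => ae_of_all _ fun x => ?_) ?_
      · by_cases hx : ∃ k < p ^ n, D n k ⊆ A ∧ x ∈ D n k
        · obtain ⟨k, hk, hkA, hxk⟩ := hx
          rw [hval n k x hk hkA hxk]
        · push Not at hx
          rw [hval0 n x fun k hk hkA => hx k hk hkA]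
          simp
      · filter_upwards [hs A hA] with x hx
        refine tendsto_const_nhds.congr' ?_
        by_cases hxA : x ∈ A
        · filter_upwards [hx hxA] with n hn
          obtain ⟨k, hk, hxk, hkA⟩ := hn
          rw [hval n k x hk hkA hxk, Set.indicator_of_mem hxA]
        · refine Filter.Eventually.of_forall fun n => ?_
          change A.indicator f x = F n x
          rw [hval0 n x fun k _ hkA hxk => hxA (hkA hxk), Set.indicator_of_notMem hxA]
    simp only [hint] at hlim
    rw [← integral_indicator hA.measurableSet]
    exact tendsto_nhds_unique hlim tendsto_const_nhds
  refine Lp.ext ((ae_eq_zero_of_forall_setIntegral_isClosed_eq_zero hfi fun C hC => ?_).trans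
    (Lp.coeFn_zero _ _ _).symm)
  have h1 := integral_add_compl hC.measurableSet hfi
  have h2 := hopen Set.univ isOpen_univ
  rw [setIntegral_univ] at h2
  rwa [hopen _ hC.isOpen_compl, h2, add_zero] at h1

end IsMultiscaleDecomposition

/-! ### Square sums in `ℝ≥0∞` and errors of best approximation -/

section SquareSummable

variable {ι : Type*} {F : ι → Type*} [∀ i, NormedAddCommGroup (F i)]

theorem memℓp_two_iff_tsum_enorm {f : ∀ i, F i} :
    Memℓp f 2 ↔ ∑' i, ‖f i‖ₑ ^ 2 ≠ ⊤ := by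
  rw [memℓp_gen_iff (by norm_num)]
  have : ∀ i, ‖f i‖ₑ ^ 2 = ((‖f i‖₊ ^ 2 : ℝ≥0) : ℝ≥0∞) := fun i => by
    rw [enorm_eq_nnnorm, ENNReal.coe_pow]
  simp only [this]
  rw [ENNReal.tsum_coe_ne_top_iff_summable, ← NNReal.summable_coe]
  simp

theorem lp_enorm_sq (f : lp F 2) : ‖f‖ₑ ^ 2 = ∑' i, ‖f i‖ₑ ^ 2 := by
  have h := lp.hasSum_norm (p := 2) (by norm_num) f
  simp only [ENNReal.toReal_ofNat, Real.rpow_ofNat] at h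
  have h2 : HasSum (fun i => (‖f i‖₊ ^ 2 : ℝ≥0)) (‖f‖₊ ^ 2) := by
    rw [← NNReal.hasSum_coe]
    simpa using h
  have h3 := (ENNReal.hasSum_coe.2 h2).tsum_eq
  simp only [ENNReal.coe_pow, ← enorm_eq_nnnorm] at h3
  exact h3.symm

theorem norm_le_of_enorm_sq_le {E G : Type*} [NormedAddCommGroup E] [NormedAddCommGroup G]
    {K : ℝ≥0∞} (hK : K ≠ ⊤) {x : E} {y : G} (h : ‖x‖ₑ ^ 2 ≤ K * ‖y‖ₑ ^ 2) :
    ‖x‖ ≤ Real.sqrt K.toReal * ‖y‖ := by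
  have h1 := ENNReal.toReal_mono (ENNReal.mul_ne_top hK (by simp)) h
  rw [ENNReal.toReal_mul, ENNReal.toReal_pow, ENNReal.toReal_pow, toReal_enorm,
    toReal_enorm] at h1
  refine (sq_le_sq₀ (norm_nonneg _) (by positivity)).1 ?_
  rwa [mul_pow, Real.sq_sqrt ENNReal.toReal_nonneg]

/-- Parseval: subtracting the projection deletes the coefficients in s and leaves the others
unchanged. -/
theorem HilbertBasis.enorm_sq_sub_starProjection {H : Type*} [NormedAddCommGroup H]
    [InnerProductSpace ℂ H] [CompleteSpace H] (b : HilbertBasis ι ℂ H) (s : Set ι)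
    [DecidablePred (· ∈ s)]
    (V : Submodule ℂ H) [V.HasOrthogonalProjection] (hV : V = Submodule.span ℂ (b '' s)) (f : H) :
    ‖f - V.starProjection f‖ₑ ^ 2 = ∑' i, if i ∈ s then 0 else ‖b.repr f i‖ₑ ^ 2 := by
  rw [← b.repr.enorm_map, lp_enorm_sq]
  refine tsum_congr fun i => ?_
  rw [b.repr_apply_apply]
  split_ifs with hi
  · have : b i ∈ V := by rw [hV]; exact Submodule.subset_span ⟨i, hi, rfl⟩
    rw [Submodule.inner_right_of_mem_orthogonal this
      (Submodule.sub_starProjection_mem_orthogonal f)]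
    simp
  · have hle : V ≤ (ℂ ∙ (b i))ᗮ := by
      rw [hV, Submodule.span_le]
      rintro _ ⟨j, hj, rfl⟩
      rw [SetLike.mem_coe, Submodule.mem_orthogonal_singleton_iff_inner_right]
      exact b.orthonormal.2 fun h => hi (h ▸ hj)
    have h2 := Submodule.mem_orthogonal_singleton_iff_inner_right.1
      (hle (V.starProjection_apply_mem f))
    rw [inner_sub_right, h2, sub_zero, ← b.repr_apply_apply]

/-- The image under U of the best approximation in V is a competitor in W. No compatibility of U
with the two projectors is needed. -/
theorem norm_sub_starProjection_map_le {H K : Type*} [NormedAddCommGroup H]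
    [InnerProductSpace ℂ H] [NormedAddCommGroup K] [InnerProductSpace ℂ K]
    (U : H →L[ℂ] K) (V : Submodule ℂ H) (W : Submodule ℂ K) [V.HasOrthogonalProjection]
    [W.HasOrthogonalProjection] (h : V.map (U : H →ₗ[ℂ] K) ≤ W) (f : H) :
    ‖U f - W.starProjection (U f)‖ₑ ^ 2 ≤ ‖U‖ₑ ^ 2 * ‖f - V.starProjection f‖ₑ ^ 2 := by
  rw [← mul_pow]
  refine pow_le_pow_left₀ zero_le ?_ 2
  have h1 : ‖U f - W.starProjection (U f)‖ ≤ ‖U f - U (V.starProjection f)‖ := by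
    rw [W.starProjection_minimal]
    exact ciInf_le (f := fun w : W => ‖U f - w‖) ⟨0, by rintro _ ⟨w, rfl⟩; positivity⟩
      ⟨U (V.starProjection f), h ⟨_, V.starProjection_apply_mem f, rfl⟩⟩
  refine (enorm_le_iff_norm_le.2 h1).trans ?_
  rw [← map_sub]
  exact U.le_opENorm _

end SquareSummable

/-! ### Passing between L² spaces of comparable measures -/

section ChangeOfMeasure

variable {X : Type*} [MeasurableSpace X] {μ ν : Measure X}

/-- The identity as a map `L²(ν) → L²(μ)`, where `μ` is bounded by a multiple of `ν`. -/
def changeMeasureL2 {C : ℝ≥0∞} (hC : C ≠ ⊤) (h : μ ≤ C • ν) : Lp ℂ 2 ν →L[ℂ] Lp ℂ 2 μ where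
  toFun := Lp.LpToLpOfMeasureLeSMul hC h
  map_add' := map_add _
  map_smul' c f := by
    refine Lp.ext ?_
    have hac : μ ≪ ν := Measure.absolutelyContinuous_of_le_smul h
    filter_upwards [Lp.coeFn_LpToLpOfMeasureLeSMul hC h (c • f),
      Lp.coeFn_LpToLpOfMeasureLeSMul hC h f, hac.ae_le (Lp.coeFn_smul c f),
      Lp.coeFn_smul c (Lp.LpToLpOfMeasureLeSMul hC h f)] with x h1 h2 h3 h4
    rw [h1, h3, RingHom.id_apply, h4, Pi.smul_apply, Pi.smul_apply, h2]
  cont := (Lp.LpToLpOfMeasureLeSMul hC h).continuous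

theorem changeMeasureL2_coeFn {C : ℝ≥0∞} (hC : C ≠ ⊤) (h : μ ≤ C • ν) (f : Lp ℂ 2 ν) :
    changeMeasureL2 hC h f =ᵐ[μ] f :=
  Lp.coeFn_LpToLpOfMeasureLeSMul hC h f

theorem changeMeasureL2_leftInverse {C C' : ℝ≥0∞} (hC : C ≠ ⊤) (h : μ ≤ C • ν) (hC' : C' ≠ ⊤)
    (h' : ν ≤ C' • μ) (f : Lp ℂ 2 ν) : changeMeasureL2 hC' h' (changeMeasureL2 hC h f) = f := by
  refine Lp.ext ((changeMeasureL2_coeFn hC' h' _).trans ?_)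
  exact (Measure.absolutelyContinuous_of_le_smul h').ae_le (changeMeasureL2_coeFn hC h f)

/-- The spaces `L²(ν)` and `L²(μ)` of comparable measures are isomorphic. -/
def changeMeasureEquiv {C C' : ℝ≥0∞} (hC : C ≠ ⊤) (h : μ ≤ C • ν) (hC' : C' ≠ ⊤)
    (h' : ν ≤ C' • μ) : Lp ℂ 2 ν ≃L[ℂ] Lp ℂ 2 μ :=
  ContinuousLinearEquiv.equivOfInverse (changeMeasureL2 hC h) (changeMeasureL2 hC' h')
    (changeMeasureL2_leftInverse hC h hC' h') (changeMeasureL2_leftInverse hC' h' hC h)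

theorem changeMeasureL2_indicatorL2 [IsFiniteMeasure μ] [IsFiniteMeasure ν] {C : ℝ≥0∞}
    (hC : C ≠ ⊤) (h : μ ≤ C • ν) {A : Set X} (hA : NullMeasurableSet A ν) :
    changeMeasureL2 hC h (indicatorL2 ν A) = indicatorL2 μ A := by
  have hac : μ ≪ ν := Measure.absolutelyContinuous_of_le_smul h
  exact Lp.ext ((changeMeasureL2_coeFn hC h _).trans
    ((hac.ae_eq (indicatorL2_coeFn hA)).trans (indicatorL2_coeFn (hA.mono_ac hac)).symm))

theorem changeMeasureL2_identVec [IsFiniteMeasure μ] [IsFiniteMeasure ν] {C : ℝ≥0∞}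
    (hC : C ≠ ⊤) (h : μ ≤ C • ν) {p : ℕ} {Ω : Set X} {D : ℕ → ℕ → Set X}
    (hD : IsMultiscaleDecomposition ν p Ω D) (z : TreeIndex p) :
    changeMeasureL2 hC h (identVec ν p Ω D z) = identVec μ p Ω D z := by
  cases z with
  | rad =>
    refine changeMeasureL2_indicatorL2 hC h ?_
    rw [← hD.root]
    exact hD.measurable 0 0 (by simp)
  | node n k t =>
    simp only [identVec, map_smul, map_sum]
    congr 1
    refine Finset.sum_congr rfl fun j hj => ?_
    rw [changeMeasureL2_indicatorL2 hC h
      (hD.measurable _ _ (child_lt k.2 (Finset.mem_range.1 hj)))]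

theorem map_scaleSpace [IsFiniteMeasure μ] [IsFiniteMeasure ν] {C : ℝ≥0∞}
    (hC : C ≠ ⊤) (h : μ ≤ C • ν) {p : ℕ} {Ω : Set X} {D : ℕ → ℕ → Set X}
    (hD : IsMultiscaleDecomposition ν p Ω D) (n : ℕ) :
    (scaleSpace ν p D n).map (changeMeasureL2 hC h : Lp ℂ 2 ν →ₗ[ℂ] Lp ℂ 2 μ) =
      scaleSpace μ p D n := by
  rw [scaleSpace, Submodule.map_span, ← Set.range_comp]
  congr 2
  funext k
  exact changeMeasureL2_indicatorL2 hC h (hD.measurable n k k.2)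

theorem enorm_sq_sub_scaleProj_le [IsFiniteMeasure μ] [IsFiniteMeasure ν] {C : ℝ≥0∞}
    (hC : C ≠ ⊤) (h : μ ≤ C • ν) {p : ℕ} {Ω : Set X} {D : ℕ → ℕ → Set X}
    (hD : IsMultiscaleDecomposition ν p Ω D) (n : ℕ) (f : Lp ℂ 2 ν) :
    ‖changeMeasureL2 hC h f - scaleProj μ p D n (changeMeasureL2 hC h f)‖ₑ ^ 2 ≤
      ‖changeMeasureL2 hC h‖ₑ ^ 2 * ‖f - scaleProj ν p D n f‖ₑ ^ 2 :=
  norm_sub_starProjection_map_le _ _ _ (map_scaleSpace hC h hD n).le f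

end ChangeOfMeasure

/-! ### Comparison of the accumulated weights with the weights of ℓ²_r -/

section Weights

/-- The accumulated weights `∑ₙ p ^ (2 n s / d)`, `n ≤ ν(z)`. -/
def cumulatedWeight (p d : ℕ) (s : ℝ) (z : TreeIndex p) : ℝ≥0∞ :=
  ∑' n : ℕ, if z.gen < n then 0 else ‖(approxWeight p d s n : ℂ)‖ₑ ^ 2

theorem enorm_approxWeight_sq (p d : ℕ) (s : ℝ) (n : ℕ) :
    ‖(approxWeight p d s n : ℂ)‖ₑ ^ 2 = ENNReal.ofReal (approxWeight p d s n ^ 2) := by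
  rw [← ofReal_norm, Complex.norm_real, ← ENNReal.ofReal_pow (norm_nonneg _), Real.norm_eq_abs,
    sq_abs]

theorem enorm_weight_sq (p : ℕ) (r : ℝ) (m : ℝ) :
    ‖(((p : ℝ) ^ (r * m) : ℝ) : ℂ)‖ₑ ^ 2 = ENNReal.ofReal ((p : ℝ) ^ (2 * r * m)) := by
  rw [← ofReal_norm, Complex.norm_real, ← ENNReal.ofReal_pow (norm_nonneg _), Real.norm_eq_abs,
    sq_abs, ← Real.rpow_mul_natCast (Nat.cast_nonneg p)]
  congr 2
  push_cast
  ring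

theorem cumulatedWeight_rad (p d : ℕ) (s : ℝ) : cumulatedWeight p d s .rad = 0 :=
  ENNReal.tsum_eq_zero.2 fun n => if_pos (by simp only [TreeIndex.gen]; omega)

theorem cumulatedWeight_node (p d : ℕ) (s : ℝ) (n : ℕ) (k : Fin (p ^ n)) (t : Fin (p - 1)) :
    cumulatedWeight p d s (.node n k t) =
      ENNReal.ofReal (∑ m ∈ Finset.range (n + 1), approxWeight p d s m ^ 2) := by
  rw [cumulatedWeight, tsum_eq_sum (s := Finset.range (n + 1)),
    ENNReal.ofReal_sum_of_nonneg fun _ _ => sq_nonneg _]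
  · refine Finset.sum_congr rfl fun m hm => ?_
    rw [Finset.mem_range] at hm
    rw [if_neg (by simp only [TreeIndex.gen]; omega), enorm_approxWeight_sq]
  · intro m hm
    rw [Finset.mem_range] at hm
    rw [if_pos (by simp only [TreeIndex.gen]; omega)]

theorem approxWeight_sq {p d : ℕ} {s : ℝ} (hs : s ≠ 0) (n : ℕ) :
    approxWeight p d s n ^ 2 = ((p : ℝ) ^ (2 * s / d)) ^ n := by
  rw [approxWeight, if_neg fun h => hs h.1, ← Real.rpow_mul_natCast (Nat.cast_nonneg p),
    ← Real.rpow_mul_natCast (Nat.cast_nonneg p)]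
  congr 1
  push_cast
  ring

theorem sum_approxWeight_sq_of_eq_zero (p d n : ℕ) :
    ∑ m ∈ Finset.range (n + 1), approxWeight p d 0 m ^ 2 = 1 := by
  rw [Finset.sum_eq_single_of_mem 0 (by simp) fun m _ hm => by simp [approxWeight, hm]]
  simp [approxWeight]

/-- For s > 0 the sum is geometric with ratio q = p^(2s/d) > 1, hence at most q/(q - 1) times its
last term qⁿ, and qⁿ ≤ p^(2rn) because s ≤ rd. For s = 0 the ratio would be 1. There only the term n
= 0 is kept and the sum is 1. -/
theorem exists_cumulatedWeight_le {p d : ℕ} (hd : 0 < d) [p.AtLeastTwo] {r s : ℝ} (hr : 0 ≤ r)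
    (hs0 : 0 ≤ s) (hs : s ≤ r * d) :
    ∃ C : ℝ≥0∞, C ≠ ⊤ ∧ ∀ z : TreeIndex p,
      cumulatedWeight p d s z ≤ C * ENNReal.ofReal ((p : ℝ) ^ (2 * r * (z.gen : ℝ))) := by
  have hp1 : (1 : ℝ) < p := Nat.one_lt_cast.2 (Nat.AtLeastTwo.prop (n := p))
  have hp0 : (0 : ℝ) < p := one_pos.trans hp1
  have hd' : (0 : ℝ) < d := Nat.cast_pos.2 hd
  rcases hs0.eq_or_lt with rfl | hs0
  · refine ⟨1, ENNReal.one_ne_top, fun z => ?_⟩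
    cases z with
    | rad => simp [cumulatedWeight_rad]
    | node n k t =>
      rw [cumulatedWeight_node, sum_approxWeight_sq_of_eq_zero, one_mul]
      refine ENNReal.ofReal_le_ofReal (Real.one_le_rpow hp1.le ?_)
      simp only [TreeIndex.gen]
      positivity
  · set q : ℝ := (p : ℝ) ^ (2 * s / d) with hq
    have hq1 : 1 < q := Real.one_lt_rpow hp1 (by positivity)
    refine ⟨ENNReal.ofReal (q / (q - 1)), ENNReal.ofReal_ne_top, fun z => ?_⟩
    cases z with
    | rad => simp [cumulatedWeight_rad]
    | node n k t =>
      rw [cumulatedWeight_node, ← ENNReal.ofReal_mul (div_nonneg (by linarith) (by linarith))]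
      refine ENNReal.ofReal_le_ofReal ?_
      simp only [approxWeight_sq hs0.ne', ← hq]
      rw [geom_sum_eq hq1.ne']
      have h1 : q ^ n ≤ (p : ℝ) ^ (2 * r * ((TreeIndex.node n k t).gen : ℝ)) := by
        rw [hq, ← Real.rpow_mul_natCast hp0.le]
        refine Real.rpow_le_rpow_of_exponent_le hp1.le ?_
        simp only [TreeIndex.gen, Int.cast_natCast]
        refine mul_le_mul_of_nonneg_right ?_ (Nat.cast_nonneg n)
        rw [div_le_iff₀ hd']
        linarith
      calc (q ^ (n + 1) - 1) / (q - 1) ≤ q ^ (n + 1) / (q - 1) :=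
            div_le_div_of_nonneg_right (by linarith) (by linarith)
        _ = q / (q - 1) * q ^ n := by rw [pow_succ]; ring
        _ ≤ _ := mul_le_mul_of_nonneg_left h1 (div_nonneg (by linarith) (by linarith))

/-- For s = rd the last term of the sum is already the full weight. The summand 1 serves the root,
whose accumulated weight is 0 and whose weight p^(-2r) is at most 1. -/
theorem weight_le_cumulatedWeight {p d : ℕ} (hd : 0 < d) [p.AtLeastTwo] {r s : ℝ} (hr : 0 ≤ r)
    (hs : s = r * d) (z : TreeIndex p) :
    ENNReal.ofReal ((p : ℝ) ^ (2 * r * (z.gen : ℝ))) ≤ 1 + cumulatedWeight p d s z := by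
  have hp1 : (1 : ℝ) < p := Nat.one_lt_cast.2 (Nat.AtLeastTwo.prop (n := p))
  have hd' : (0 : ℝ) < d := Nat.cast_pos.2 hd
  cases z with
  | rad =>
    rw [cumulatedWeight_rad, add_zero, ENNReal.ofReal_le_one]
    refine Real.rpow_le_one_of_one_le_of_nonpos hp1.le ?_
    simp [TreeIndex.gen, hr]
  | node n k t =>
    refine le_trans ?_ le_add_self
    rw [cumulatedWeight_node]
    refine ENNReal.ofReal_le_ofReal ?_
    by_cases hs0 : s = 0
    · have hr0 : r = 0 := by
        rcases mul_eq_zero.1 (hs.symm.trans hs0) with h | h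
        · exact h
        · exact absurd h hd'.ne'
      rw [hs0, sum_approxWeight_sq_of_eq_zero, hr0]
      simp
    · refine le_trans (le_of_eq ?_) (Finset.single_le_sum (f := fun m => approxWeight p d s m ^ 2)
        (fun _ _ => sq_nonneg _) (Finset.mem_range.2 (Nat.lt_succ_self n)))
      rw [approxWeight_sq hs0, ← Real.rpow_mul_natCast (Nat.cast_nonneg p), hs]
      congr 1
      simp only [TreeIndex.gen, Int.cast_natCast]
      field_simp

/-- The smallest generation is -1, so p^(-2r) is the smallest weight. This bounds the ℓ² norm by the
ℓ²_r norm. -/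
theorem one_le_weight {p : ℕ} [p.AtLeastTwo] {r : ℝ} (hr : 0 ≤ r) (z : TreeIndex p) :
    1 ≤ ENNReal.ofReal ((p : ℝ) ^ (2 * r)) *
      ENNReal.ofReal ((p : ℝ) ^ (2 * r * (z.gen : ℝ))) := by
  have hp1 : (1 : ℝ) < p := Nat.one_lt_cast.2 (Nat.AtLeastTwo.prop (n := p))
  have hp0 : (0 : ℝ) < p := one_pos.trans hp1
  rw [← ENNReal.ofReal_mul (by positivity), ← Real.rpow_add hp0, ENNReal.one_le_ofReal]
  refine Real.one_le_rpow hp1.le ?_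
  have : (-1 : ℝ) ≤ z.gen := by
    have : (-1 : ℤ) ≤ z.gen := by cases z <;> simp only [TreeIndex.gen] <;> omega
    exact_mod_cast this
  nlinarith

end Weights

/-! ### The norms of ℓ²_r and A^s -/

section Norms

theorem WeightedSeq.norm_def (p : ℕ) [p.AtLeastTwo] (r : ℝ) (a : WeightedSeq p r) :
    ‖a‖ = ‖WeightedSeq.normMap p r a‖ := rfl

theorem WeightedSeq.enorm_sq (p : ℕ) [p.AtLeastTwo] (r : ℝ) (a : WeightedSeq p r) :
    ‖a‖ₑ ^ 2 = ∑' z : TreeIndex p, ENNReal.ofReal ((p : ℝ) ^ (2 * r * (z.gen : ℝ))) *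
      ‖WeightedSeq.toFun p r a z‖ₑ ^ 2 := by
  have h : ‖a‖ₑ = ‖WeightedSeq.normMap p r a‖ₑ := by
    rw [← ofReal_norm, ← ofReal_norm, WeightedSeq.norm_def]
  rw [h, lp_enorm_sq]
  refine tsum_congr fun z => ?_
  rw [← enorm_weight_sq, ← mul_pow, ← enorm_mul]
  rfl

/-- The norm is pulled back along `normMap`, so density may be checked in ℓ², where finite
truncations converge. -/
theorem WeightedSeq.denseRange_ofFinsupp (p : ℕ) [p.AtLeastTwo] (r : ℝ) :
    DenseRange (WeightedSeq.ofFinsupp p r) := by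
  classical
  have hiso : Isometry (WeightedSeq.normMap p r) :=
    AddMonoidHomClass.isometry_of_norm _ fun a => (WeightedSeq.norm_def p r a).symm
  intro a
  rw [hiso.isUniformInducing.isInducing.closure_eq_preimage_closure_image, Set.mem_preimage]
  have h := lp.hasSum_single (p := 2) (by norm_num) (WeightedSeq.normMap p r a)
  refine mem_closure_of_tendsto h (Filter.Eventually.of_forall fun F => ?_)
  refine ⟨WeightedSeq.ofFinsupp p r (∑ z ∈ F, Finsupp.single z (WeightedSeq.toFun p r a z)),
    ⟨_, rfl⟩, ?_⟩
  simp only [map_sum]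
  refine Finset.sum_congr rfl fun z _ => Subtype.ext (funext fun w => ?_)
  have h1 : (WeightedSeq.normMap p r (WeightedSeq.ofFinsupp p r
      (Finsupp.single z (WeightedSeq.toFun p r a z)))).1 w =
      (((p : ℝ) ^ (r * (w.gen : ℝ)) : ℝ) : ℂ) * Finsupp.single z (WeightedSeq.toFun p r a z) w :=
    rfl
  have h2 : WeightedSeq.normMap p r a z =
      (((p : ℝ) ^ (r * (z.gen : ℝ)) : ℝ) : ℂ) * WeightedSeq.toFun p r a z := rfl
  rw [h1, lp.coeFn_single, h2]
  by_cases hw : w = z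
  · subst hw
    simp
  · rw [Finsupp.single_eq_of_ne hw, Pi.single_eq_of_ne hw, mul_zero]

variable {X : Type*} [MeasurableSpace X] (μ : Measure X) (p d : ℕ) (D : ℕ → ℕ → Set X) (s : ℝ)

/-- The approximation part `∑ₙ p ^ (2 n s / d) ‖f - Pₙ f‖²` of the norm. -/
def approxEnergy (f : Lp ℂ 2 μ) : ℝ≥0∞ :=
  ∑' n, ‖(approxWeight p d s n : ℂ)‖ₑ ^ 2 * ‖f - scaleProj μ p D n f‖ₑ ^ 2

theorem mem_approxSubmodule_iff (f : Lp ℂ 2 μ) :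
    f ∈ approxSubmodule μ p d D s ↔ approxEnergy μ p d D s f ≠ ⊤ := by
  refine (memℓp_two_iff_tsum_enorm (f := approxError μ p d D s f)).trans ?_
  simp only [approxEnergy, approxError, LinearMap.coe_mk, AddHom.coe_mk, enorm_smul, mul_pow]

theorem ApproxSpace.enorm_sq (f : ApproxSpace μ p d D s) :
    ‖f‖ₑ ^ 2 = ‖scaleProj μ p D 0 (ApproxSpace.toL2 μ p d D s f)‖ₑ ^ 2 +
      approxEnergy μ p d D s (ApproxSpace.toL2 μ p d D s f) := by
  have h : ‖f‖ = ‖ApproxSpace.normMap μ p d D s f‖ := rfl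
  have h1 : ‖f‖ₑ = ‖ApproxSpace.normMap μ p d D s f‖ₑ := by
    rw [← ofReal_norm, ← ofReal_norm, h]
  have h2 : ∀ x : WithLp 2 (Lp ℂ 2 μ × lp (fun _ : ℕ => Lp ℂ 2 μ) 2),
      ‖x‖ₑ ^ 2 = ‖x.fst‖ₑ ^ 2 + ‖x.snd‖ₑ ^ 2 := by
    intro x
    simp only [← ofReal_norm]
    rw [← ENNReal.ofReal_pow (norm_nonneg _), ← ENNReal.ofReal_pow (norm_nonneg _),
      ← ENNReal.ofReal_pow (norm_nonneg _), WithLp.prod_norm_sq_eq_of_L2,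
      ENNReal.ofReal_add (sq_nonneg _) (sq_nonneg _)]
  rw [h1, h2, lp_enorm_sq]
  congr 1
  refine tsum_congr fun n => ?_
  rw [← mul_pow, ← enorm_smul]
  rfl

/-- Pythagoras for `P₀`. The term n = 0 of the energy has weight 1 for every s, including s = 0. -/
theorem enorm_sq_le_approxEnergy (f : Lp ℂ 2 μ) :
    ‖f‖ₑ ^ 2 ≤ ‖scaleProj μ p D 0 f‖ₑ ^ 2 + approxEnergy μ p d D s f := by
  have h1 : ‖f‖ₑ ^ 2 = ‖scaleProj μ p D 0 f‖ₑ ^ 2 + ‖f - scaleProj μ p D 0 f‖ₑ ^ 2 := by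
    simp only [← ofReal_norm]
    rw [← ENNReal.ofReal_pow (norm_nonneg _), ← ENNReal.ofReal_pow (norm_nonneg _),
      ← ENNReal.ofReal_pow (norm_nonneg _), ← ENNReal.ofReal_add (sq_nonneg _) (sq_nonneg _)]
    congr 1
    have h := norm_add_sq_eq_norm_sq_add_norm_sq_of_inner_eq_zero (𝕜 := ℂ)
      (scaleProj μ p D 0 f) (f - scaleProj μ p D 0 f)
      (Submodule.inner_right_of_mem_orthogonal
        ((scaleSpace μ p D 0).starProjection_apply_mem f)
        (Submodule.sub_starProjection_mem_orthogonal f))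
    rw [add_sub_cancel] at h
    simpa only [sq] using h
  rw [h1]
  gcongr
  refine le_trans ?_ (ENNReal.le_tsum 0)
  simp [approxWeight]

theorem enorm_scaleProj_le (n : ℕ) (f : Lp ℂ 2 μ) : ‖scaleProj μ p D n f‖ₑ ≤ ‖f‖ₑ :=
  enorm_le_iff_norm_le.2 ((scaleSpace μ p D n).norm_starProjection_apply_le f)

variable {μ p d D s} {ν : Measure X} [IsFiniteMeasure μ] [IsFiniteMeasure ν] {Ω : Set X}

theorem approxEnergy_changeMeasure_le {C : ℝ≥0∞}
    (hC : C ≠ ⊤) (h : μ ≤ C • ν) (hD : IsMultiscaleDecomposition ν p Ω D) (f : Lp ℂ 2 ν) :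
    approxEnergy μ p d D s (changeMeasureL2 hC h f) ≤
      ‖changeMeasureL2 hC h‖ₑ ^ 2 * approxEnergy ν p d D s f := by
  rw [approxEnergy, approxEnergy, ← ENNReal.tsum_mul_left]
  refine ENNReal.tsum_le_tsum fun n => ?_
  rw [mul_left_comm]
  gcongr
  exact enorm_sq_sub_scaleProj_le hC h hD n f

/-- Over a balanced measure the approximation energy is a weighted sum of the coefficients. -/
theorem approxEnergy_eq_tsum [p.AtLeastTwo] (hD : IsMultiscaleDecomposition ν p Ω D)
    (b : HilbertBasis (TreeIndex p) ℂ (Lp ℂ 2 ν)) (hb : ⇑b = identVec ν p Ω D) (f : Lp ℂ 2 ν) :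
    approxEnergy ν p d D s f = ∑' z, cumulatedWeight p d s z * ‖b.repr f z‖ₑ ^ 2 := by
  classical
  have h1 : ∀ n : ℕ, ‖f - scaleProj ν p D n f‖ₑ ^ 2 =
      ∑' z, if z ∈ {z : TreeIndex p | z.gen < n} then 0 else ‖b.repr f z‖ₑ ^ 2 := fun n => by
    refine b.enorm_sq_sub_starProjection {z : TreeIndex p | z.gen < n} (scaleSpace ν p D n) ?_ f
    rw [hb, hD.identVec_eq_treeVec]
    exact treeSpan_eq_span_treeVec hD.isRefinable n
  simp only [approxEnergy, cumulatedWeight, h1, ← ENNReal.tsum_mul_left, ← ENNReal.tsum_mul_right]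
  -- The coefficient at z contributes to the error at level n exactly when n ≤ gen z. Collecting
  -- these levels for fixed z gives the accumulated weight.
  rw [ENNReal.tsum_comm]
  refine tsum_congr fun z => tsum_congr fun n => ?_
  simp only [Set.mem_ofPred_eq]
  split_ifs <;> simp

end Norms

/-! ### The identification operator for a measure comparable to a balanced one -/

section Identification

variable {X : Type*} [MeasurableSpace X] {μ ν : Measure X} [IsFiniteMeasure μ] [IsFiniteMeasure ν]
  {p d : ℕ} [p.AtLeastTwo] {Ω : Set X} {D : ℕ → ℕ → Set X} {r s : ℝ}

/-- If `μ` is comparable to a measure `ν` over which the decomposition is balanced and generates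
`L²`, the identification operator has the asserted mapping properties. -/
theorem exists_identification_of_comparable (hd : 0 < d) {C C' : ℝ≥0∞} (hC : C ≠ ⊤)
    (hμν : μ ≤ C • ν) (hC' : C' ≠ ⊤) (hνμ : ν ≤ C' • μ)
    (hD : IsMultiscaleDecomposition ν p Ω D)
    (hbal : ∀ n k, k < p ^ n → ν (D n k) = ((p : ℝ≥0∞) ^ n)⁻¹)
    (hdense : (Submodule.span ℂ (Set.range (identVec ν p Ω D))).topologicalClosure = ⊤)
    (hr : 0 ≤ r) (hs0 : 0 ≤ s) (hs : s ≤ r * d) :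
    ∃ T : WeightedSeq p r →L[ℂ] ApproxSpace μ p d D s,
      (∀ a : TreeIndex p →₀ ℂ,
        ApproxSpace.toL2 _ p d D s (T (WeightedSeq.ofFinsupp p r a)) = identMap μ p Ω D a) ∧
      (∀ T' : WeightedSeq p r →L[ℂ] ApproxSpace μ p d D s,
        (∀ a : TreeIndex p →₀ ℂ,
          ApproxSpace.toL2 _ p d D s (T' (WeightedSeq.ofFinsupp p r a)) = identMap μ p Ω D a) →
            T' = T) ∧
      Function.Injective T ∧
      (s = r * d → ∃ e : WeightedSeq p r ≃L[ℂ] ApproxSpace μ p d D s, ∀ a, e a = T a) := by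
  classical
  have horth : Orthonormal ℂ (identVec ν p Ω D) := by
    rw [hD.identVec_eq_treeVec]
    exact orthonormal_treeVec hD.isRefinable (hD.isBalancedSystem hbal)
  set b : HilbertBasis (TreeIndex p) ℂ (Lp ℂ 2 ν) := HilbertBasis.mk horth hdense.ge
  have hb : ⇑b = identVec ν p Ω D := HilbertBasis.coe_mk _ _
  set U : Lp ℂ 2 ν ≃L[ℂ] Lp ℂ 2 μ := changeMeasureEquiv hC hμν hC' hνμ
  have hUapply : ∀ f, U f = changeMeasureL2 hC hμν f := fun _ => rfl
  set M : ℝ≥0∞ := ‖changeMeasureL2 hC hμν‖ₑ ^ 2 with hM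
  set M' : ℝ≥0∞ := ‖changeMeasureL2 hC' hνμ‖ₑ ^ 2 with hM'
  have hMt : M ≠ ⊤ := by simp [hM]
  have hMt' : M' ≠ ⊤ := by simp [hM']
  have hnorm : ∀ x : lp (fun _ : TreeIndex p => ℂ) 2, ‖b.repr.symm x‖ₑ ^ 2 = ∑' z, ‖x z‖ₑ ^ 2 :=
    fun x => by rw [b.repr.symm.enorm_map, lp_enorm_sq]
  have hUle : ∀ f, ‖U f‖ₑ ^ 2 ≤ M * ‖f‖ₑ ^ 2 := fun f => by
    rw [hM, ← mul_pow]
    exact pow_le_pow_left₀ zero_le ((changeMeasureL2 hC hμν).le_opENorm f) 2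
  have hUle' : ∀ f, ‖U.symm f‖ₑ ^ 2 ≤ M' * ‖f‖ₑ ^ 2 := fun f => by
    rw [hM', ← mul_pow]
    exact pow_le_pow_left₀ zero_le ((changeMeasureL2 hC' hνμ).le_opENorm f) 2
  have hDμ : IsMultiscaleDecomposition μ p Ω D :=
    hD.mono_ac (Measure.absolutelyContinuous_of_le_smul hμν)
  have hE : ∀ x : lp (fun _ : TreeIndex p => ℂ) 2, approxEnergy μ p d D s (U (b.repr.symm x)) ≤
      M * ∑' z, cumulatedWeight p d s z * ‖x z‖ₑ ^ 2 := fun x => by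
    refine (approxEnergy_changeMeasure_le hC hμν hD _).trans ?_
    rw [approxEnergy_eq_tsum hD b hb, LinearIsometryEquiv.apply_symm_apply]
  have hE' : ∀ f, ∑' z, cumulatedWeight p d s z * ‖b.repr (U.symm f) z‖ₑ ^ 2 ≤
      M' * approxEnergy μ p d D s f := fun f => by
    rw [← approxEnergy_eq_tsum hD b hb]
    exact approxEnergy_changeMeasure_le hC' hνμ hDμ f
  obtain ⟨K, hK, hKle⟩ := exists_cumulatedWeight_le (p := p) hd hr hs0 hs
  set toLp2 : WeightedSeq p r →ₗ[ℂ] lp (fun _ : TreeIndex p => ℂ) 2 :=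
    { toFun := fun a => ⟨WeightedSeq.toFun p r a, a.2.1⟩
      map_add' := fun _ _ => rfl
      map_smul' := fun _ _ => rfl } with htoLp2
  have htoLp2_apply : ∀ a z, toLp2 a z = WeightedSeq.toFun p r a z := fun _ _ => rfl
  -- Expand the coefficients in the orthonormal basis of L²(ν), then read the result in L²(μ). Both
  -- maps are bijective, so injectivity holds for every admissible s.
  set T0 : WeightedSeq p r →ₗ[ℂ] Lp ℂ 2 μ :=
    (U.toLinearEquiv : Lp ℂ 2 ν →ₗ[ℂ] Lp ℂ 2 μ) ∘ₗ
      (b.repr.symm.toLinearEquiv : lp (fun _ : TreeIndex p => ℂ) 2 →ₗ[ℂ] Lp ℂ 2 ν) ∘ₗ toLp2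
    with hT0
  have hT0_apply : ∀ a, T0 a = U (b.repr.symm (toLp2 a)) := fun _ => rfl
  have hle1 : ∀ a : WeightedSeq p r,
      ∑' z, cumulatedWeight p d s z * ‖toLp2 a z‖ₑ ^ 2 ≤ K * ‖a‖ₑ ^ 2 := fun a => by
    rw [WeightedSeq.enorm_sq, ← ENNReal.tsum_mul_left]
    refine ENNReal.tsum_le_tsum fun z => ?_
    rw [htoLp2_apply, ← mul_assoc]
    gcongr
    exact hKle z
  have hle2 : ∀ a : WeightedSeq p r,
      ∑' z, ‖toLp2 a z‖ₑ ^ 2 ≤ ENNReal.ofReal ((p : ℝ) ^ (2 * r)) * ‖a‖ₑ ^ 2 := fun a => by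
    rw [WeightedSeq.enorm_sq, ← ENNReal.tsum_mul_left]
    refine ENNReal.tsum_le_tsum fun z => ?_
    rw [htoLp2_apply, ← mul_assoc]
    exact le_mul_of_one_le_left zero_le (one_le_weight hr z)
  have hEa : ∀ a, approxEnergy μ p d D s (T0 a) ≤ M * K * ‖a‖ₑ ^ 2 := fun a => by
    rw [mul_assoc]
    exact (hE _).trans (by gcongr; exact hle1 a)
  set T1 : WeightedSeq p r →ₗ[ℂ] ApproxSpace μ p d D s :=
    LinearMap.codRestrict (approxSubmodule μ p d D s) T0 fun a =>
      (mem_approxSubmodule_iff μ p d D s _).2 (ne_top_of_le_ne_top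
        (ENNReal.mul_ne_top (ENNReal.mul_ne_top hMt hK) (by simp)) (hEa a)) with hT1
  have hT1_apply : ∀ a, ApproxSpace.toL2 μ p d D s (T1 a) = T0 a := fun _ => rfl
  have hinj2 : Function.Injective (ApproxSpace.toL2 μ p d D s) := Subtype.val_injective
  -- The first summand controls the `P₀` part through the plain ℓ² norm, the second the
  -- approximation energy.
  set K1 : ℝ≥0∞ := M * ENNReal.ofReal ((p : ℝ) ^ (2 * r)) + M * K with hK1
  have hK1t : K1 ≠ ⊤ := ENNReal.add_ne_top.2
    ⟨ENNReal.mul_ne_top hMt ENNReal.ofReal_ne_top, ENNReal.mul_ne_top hMt hK⟩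
  have hbound : ∀ a, ‖T1 a‖ₑ ^ 2 ≤ K1 * ‖a‖ₑ ^ 2 := fun a => by
    rw [ApproxSpace.enorm_sq, hT1_apply, hK1, add_mul]
    refine add_le_add ?_ (hEa a)
    refine (pow_le_pow_left₀ zero_le (enorm_scaleProj_le μ p D 0 _) 2).trans ?_
    rw [hT0_apply, mul_assoc]
    refine (hUle _).trans ?_
    rw [hnorm]
    gcongr
    exact hle2 a
  set T : WeightedSeq p r →L[ℂ] ApproxSpace μ p d D s :=
    T1.mkContinuous (Real.sqrt K1.toReal) fun a => norm_le_of_enorm_sq_le hK1t (hbound a)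
  have hinj : Function.Injective T := by
    intro a a' h
    have h1 : T0 a = T0 a' := congrArg (ApproxSpace.toL2 μ p d D s) h
    have h2 : toLp2 a = toLp2 a' := b.repr.symm.injective (U.injective h1)
    have h3 : Function.Injective (WeightedSeq.toFun p r) := Subtype.val_injective
    exact h3 (funext fun z => congrFun (congrArg Subtype.val h2) z)
  have hfin : ∀ a : TreeIndex p →₀ ℂ,
      ApproxSpace.toL2 _ p d D s (T (WeightedSeq.ofFinsupp p r a)) = identMap μ p Ω D a := by
    have : T0 ∘ₗ WeightedSeq.ofFinsupp p r = identMap μ p Ω D := by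
      refine Finsupp.lhom_ext fun z c => ?_
      have h1 : toLp2 (WeightedSeq.ofFinsupp p r (Finsupp.single z c)) =
          c • lp.single 2 z (1 : ℂ) := by
        refine Subtype.ext (funext fun w => ?_)
        have h2 : (toLp2 (WeightedSeq.ofFinsupp p r (Finsupp.single z c))).1 w =
          Finsupp.single z c w := rfl
        rw [h2, lp.coeFn_smul, Pi.smul_apply, lp.coeFn_single]
        by_cases hw : w = z
        · subst hw
          simp
        · rw [Finsupp.single_eq_of_ne hw, Pi.single_eq_of_ne hw, smul_zero]
      rw [LinearMap.comp_apply, hT0_apply, h1, map_smul, map_smul, b.repr_symm_single, hb,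
        hUapply, changeMeasureL2_identVec hC hμν hD, identMap, Finsupp.linearCombination_single]
    exact fun a => LinearMap.congr_fun this a
  refine ⟨T, hfin, fun T' hT' => ?_, hinj, fun hsr => ?_⟩
  · refine DFunLike.coe_injective ((WeightedSeq.denseRange_ofFinsupp p r).equalizer
      T'.continuous T.continuous (funext fun a => hinj2 ?_))
    exact (hT' a).trans (hfin a).symm
  -- The lower bound holds in `ℝ≥0∞` for every f in L²(μ). It therefore gives surjectivity (the
  -- coefficients of f ∈ A^s lie in ℓ²_r) as well as boundedness of the inverse. The factor 2 comes
  -- from the two summands in `weight_le_cumulatedWeight`.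
  · have hlow : ∀ f : Lp ℂ 2 μ, ∑' z : TreeIndex p,
        ENNReal.ofReal ((p : ℝ) ^ (2 * r * (z.gen : ℝ))) *
        ‖b.repr (U.symm f) z‖ₑ ^ 2 ≤
        2 * M' * (‖scaleProj μ p D 0 f‖ₑ ^ 2 + approxEnergy μ p d D s f) := by
      intro f
      calc _ ≤ ∑' z : TreeIndex p, (‖b.repr (U.symm f) z‖ₑ ^ 2 +
            cumulatedWeight p d s z * ‖b.repr (U.symm f) z‖ₑ ^ 2) := by
              refine ENNReal.tsum_le_tsum fun z => ?_
              rw [← one_add_mul]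
              gcongr
              exact weight_le_cumulatedWeight hd hr hsr z
        _ = ‖U.symm f‖ₑ ^ 2 +
            ∑' z : TreeIndex p, cumulatedWeight p d s z * ‖b.repr (U.symm f) z‖ₑ ^ 2 := by
              rw [ENNReal.tsum_add, ← lp_enorm_sq, b.repr.enorm_map]
        _ ≤ M' * (‖scaleProj μ p D 0 f‖ₑ ^ 2 + approxEnergy μ p d D s f) +
            M' * (‖scaleProj μ p D 0 f‖ₑ ^ 2 + approxEnergy μ p d D s f) := by
              refine add_le_add ((hUle' f).trans ?_) ((hE' f).trans ?_)
              · gcongr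
                exact enorm_sq_le_approxEnergy μ p d D s f
              · gcongr
                exact le_add_self
        _ = _ := by ring
    have hsurj : Function.Surjective T1 := by
      intro f
      set x := b.repr (U.symm (ApproxSpace.toL2 μ p d D s f)) with hx
      have hmem : Memℓp (weightSeq p r x) 2 := by
        rw [memℓp_two_iff_tsum_enorm]
        have h1 : ∀ z, ‖weightSeq p r x z‖ₑ ^ 2 =
            ENNReal.ofReal ((p : ℝ) ^ (2 * r * (z.gen : ℝ))) * ‖x z‖ₑ ^ 2 := fun z => by
          rw [← enorm_weight_sq, ← mul_pow, ← enorm_mul]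
          rfl
        simp only [h1]
        refine ne_top_of_le_ne_top (ENNReal.mul_ne_top (ENNReal.mul_ne_top (by simp) hMt') ?_)
          (hlow (ApproxSpace.toL2 μ p d D s f))
        rw [← ApproxSpace.enorm_sq]
        simp
      obtain ⟨a, h2⟩ : ∃ a, toLp2 a = x := ⟨⟨x, x.2, hmem⟩, rfl⟩
      refine ⟨a, hinj2 ?_⟩
      rw [hT1_apply, hT0_apply, h2, hx, LinearIsometryEquiv.symm_apply_apply,
        ContinuousLinearEquiv.apply_symm_apply]
    have hlow' : ∀ a, ‖a‖ₑ ^ 2 ≤ 2 * M' * ‖T1 a‖ₑ ^ 2 := fun a => by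
      have h1 := hlow (T0 a)
      rw [hT0_apply, ContinuousLinearEquiv.symm_apply_apply,
        LinearIsometryEquiv.apply_symm_apply] at h1
      rw [WeightedSeq.enorm_sq, ApproxSpace.enorm_sq]
      exact h1
    set L : WeightedSeq p r ≃ₗ[ℂ] ApproxSpace μ p d D s :=
      LinearEquiv.ofBijective T1 ⟨hinj, hsurj⟩ with hL
    refine ⟨L.toContinuousLinearEquivOfBounds (Real.sqrt K1.toReal)
      (Real.sqrt (2 * M').toReal) (fun a => norm_le_of_enorm_sq_le hK1t (hbound a))
      (fun f => ?_), fun a => rfl⟩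
    have h1 := norm_le_of_enorm_sq_le (ENNReal.mul_ne_top (by simp) hMt') (hlow' (L.symm f))
    have h2 : T1 (L.symm f) = f := L.apply_symm_apply f
    rwa [h2] at h1

end Identification

/-! ### Ancestors in the p-ary tree -/

theorem IsMultiscaleDecomposition.subset_ancestor {X : Type*} [MeasurableSpace X] {μ : Measure X}
    {p : ℕ} [p.AtLeastTwo] {Ω : Set X} {D : ℕ → ℕ → Set X}
    (h : IsMultiscaleDecomposition μ p Ω D) {N K : ℕ} (hK : K < p ^ N) (m : ℕ) :
    ∀ k < p ^ m, p ^ m * K + k < p ^ (N + m) ∧ D (N + m) (p ^ m * K + k) ⊆ D N K := by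
  induction m with
  | zero =>
    intro k hk
    obtain rfl : k = 0 := by simpa using hk
    simpa using hK
  | succ m ih =>
    intro k hk
    have hp : 0 < p := NeZero.pos p
    have hj : k % p < p := Nat.mod_lt _ hp
    -- Removing the last base-p digit of k passes to the parent.
    obtain ⟨h1, h2⟩ := ih (k / p) (Nat.div_lt_of_lt_mul (hk.trans_eq (by ring)))
    have h3 : p ^ (m + 1) * K + k = p * (p ^ m * K + k / p) + k % p := by
      rw [pow_succ, mul_add, add_assoc, Nat.div_add_mod]
      ring
    rw [h3, ← add_assoc]
    exact ⟨child_lt h1 hj, (h.child_subset _ _ _ h1 hj).trans h2⟩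

theorem exists_ancestor_index {p N m k : ℕ} (hk : k < p ^ (N + m)) [p.AtLeastTwo] :
    ∃ K < p ^ N, ∃ k' < p ^ m, k = p ^ m * K + k' := by
  have hp : 0 < p ^ m := pow_pos (NeZero.pos p) m
  exact ⟨k / p ^ m, Nat.div_lt_of_lt_mul (hk.trans_eq (by ring)), k % p ^ m, Nat.mod_lt _ hp,
    (Nat.div_add_mod _ _).symm⟩

/-! ### Shrinking of the pieces and the balanced measure on the manifold -/

namespace IsRegularStronglyBalanced

variable {d p : ℕ} [p.AtLeastTwo] {S : Type*} [TopologicalSpace S]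
    [T2Space S] [ChartedSpace (EuclideanSpace ℝ (Fin d)) S]
    [IsManifold (𝓡 d) ∞ S] [MeasurableSpace S] [BorelSpace S] {g : SmoothMetric d S}
    {Ω : Set S} {D : ℕ → ℕ → Set S}

/-- The pieces containing a point shrink to this point. -/
theorem eventually_subset (hd : 0 < d) (hD : IsRegularStronglyBalanced g p Ω D) {x : S}
    (hx : ∀ n, ∃ k < p ^ n, x ∈ D n k) {B : Set S} (hB : IsOpen B) (hxB : x ∈ B) :
    ∀ᶠ n in Filter.atTop, ∃ k < p ^ n, x ∈ D n k ∧ D n k ⊆ B := by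
  obtain ⟨N, φ, hφ⟩ := hD.charts
  obtain ⟨K, hK, hxK⟩ := hx N
  obtain ⟨-, hcl, -, -, -, -, hE⟩ := hφ K hK
  have hsrc : D N K ⊆ (φ K).source := subset_closure.trans hcl
  obtain ⟨c₁, hc₁, hdiam⟩ := hE.diam_le
  have hV : IsOpen (inChart (φ K) B) := (φ K).isOpen_inter_preimage_symm hB
  have hxV : φ K x ∈ inChart (φ K) B :=
    ⟨(φ K).map_source (hsrc hxK), by simpa [(φ K).left_inv (hsrc hxK)] using hxB⟩
  obtain ⟨ε, hε, hball⟩ := Metric.isOpen_iff.1 hV _ hxV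
  have hp1 : (1 : ℝ) < p := Nat.one_lt_cast.2 (Nat.AtLeastTwo.prop (n := p))
  -- The diameter bounds in the chart decay geometrically, with ratio p^(-1/d) < 1. Here m counts
  -- generations beyond N.
  have hlim : Filter.Tendsto (fun m : ℕ => c₁ * (p : ℝ) ^ (-((m : ℝ) / d))) Filter.atTop
      (nhds 0) := by
    have h1 : ∀ m : ℕ, (p : ℝ) ^ (-((m : ℝ) / d)) = ((p : ℝ) ^ (-(1 / d : ℝ))) ^ m := fun m => by
      rw [← Real.rpow_mul_natCast (by positivity)]
      congr 1
      ring
    simp only [h1]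
    have h2 := tendsto_pow_atTop_nhds_zero_of_lt_one (r := (p : ℝ) ^ (-(1 / d : ℝ)))
      (by positivity) (Real.rpow_lt_one_of_one_lt_of_neg hp1 (by
        have : (0 : ℝ) < d := Nat.cast_pos.2 hd
        simpa using this))
    simpa using h2.const_mul c₁
  obtain ⟨m₀, hm₀⟩ := Filter.eventually_atTop.1 (hlim.eventually_lt_const hε)
  filter_upwards [Filter.eventually_ge_atTop (N + m₀)] with n hn
  obtain ⟨m, rfl⟩ : ∃ m, n = N + m := ⟨n - N, by omega⟩
  obtain ⟨k, hk, hxk⟩ := hx (N + m)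
  obtain ⟨K', hK', k', hk', rfl⟩ := exists_ancestor_index hk
  have hsub := (hD.decomposition.subset_ancestor hK' m k' hk').2
  -- The ancestor of generation N of any piece containing x is the one that contains x, so a single
  -- chart serves all n.
  obtain rfl : K' = K := by
    by_contra hne
    exact Set.disjoint_left.1 (hD.decomposition.disjoint N K' K hK' hK hne) (hsub hxk) hxK
  refine ⟨_, hk, hxk, fun y hy => ?_⟩
  have hys := hsrc (hsub hy)
  have hxs := hsrc hxK
  have hmem : ∀ z ∈ D (N + m) (p ^ m * K' + k'),
      φ K' z ∈ inChart (φ K') (D (N + m) (p ^ m * K' + k')) := fun z hz => by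
    have hzs := hsrc (hsub hz)
    exact ⟨(φ K').map_source hzs, by simpa [(φ K').left_inv hzs] using hz⟩
  have h1 := (Metric.edist_le_ediam_of_mem (hmem y hy) (hmem x hxk)).trans (hdiam m k' hk')
  have h2 : dist (φ K' y) (φ K' x) < ε := by
    rw [edist_dist] at h1
    exact ((ENNReal.ofReal_le_ofReal_iff (by positivity)).1 h1).trans_lt (hm₀ m (by omega))
  have h3 := (hball h2).2
  rwa [Set.mem_preimage, (φ K').left_inv hys] at h3

/-- There is a measure comparable to the Riemannian volume on `Ω` over which the decomposition is
exactly balanced. -/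
theorem exists_balanced_measure (hD : IsRegularStronglyBalanced g p Ω D)
    (hΩc : IsCompact (closure Ω)) :
    ∃ ν : Measure S, IsFiniteMeasure ν ∧
      (∃ C : ℝ≥0∞, C ≠ ⊤ ∧ (riemannianVolume g).restrict Ω ≤ C • ν) ∧
      (∃ C : ℝ≥0∞, C ≠ ⊤ ∧ ν ≤ C • (riemannianVolume g).restrict Ω) ∧
      ∀ n k, k < p ^ n → ν (D n k) = ((p : ℝ≥0∞) ^ n)⁻¹ := by
  obtain ⟨N, φ, hφ⟩ := hD.charts
  have hdec := hD.decomposition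
  have hp0 : (p : ℝ≥0∞) ≠ 0 := Nat.cast_ne_zero.2 (NeZero.ne p)
  have hpN : ∀ n, (p : ℝ≥0∞) ^ n ≠ 0 := fun n => pow_ne_zero n hp0
  have hpN' : ∀ n, (p : ℝ≥0∞) ^ n ≠ ⊤ := fun n => ENNReal.pow_ne_top (by simp)
  set v : ℕ → ℝ≥0∞ := fun K => volume (inChart (φ K) (D N K)) with hv
  have hsrc : ∀ K, K < p ^ N → D N K ⊆ (φ K).source := fun K hK =>
    subset_closure.trans (hφ K hK).2.1
  have hmeas : ∀ K, K < p ^ N → MeasurableSet (D N K) := fun K hK =>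
    (isOpen_of_isOpen_inChart (hsrc K hK) (hφ K hK).2.2.1).measurableSet
  have hv0 : ∀ K, K < p ^ N → v K ≠ 0 := fun K hK => by
    obtain ⟨x, hx⟩ := hdec.nonempty N K hK
    refine ((hφ K hK).2.2.1.measure_pos volume ⟨φ K x, ?_⟩).ne'
    exact ⟨(φ K).map_source (hsrc K hK hx), by simpa [(φ K).left_inv (hsrc K hK hx)] using hx⟩
  have hvt : ∀ K, K < p ^ N → v K ≠ ⊤ := fun K hK => (hφ K hK).2.2.2.1.measure_lt_top.ne
  -- This weight gives the piece K mass p^(-N). The Lebesgue volume `v K` is positive and finite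
  -- because the piece is nonempty, open and bounded in its chart.
  set w : ℕ → ℝ≥0∞ := fun K => ((p : ℝ≥0∞) ^ N)⁻¹ * (v K)⁻¹ with hw
  have hw0 : ∀ K, K < p ^ N → w K ≠ 0 := fun K hK =>
    mul_ne_zero (ENNReal.inv_ne_zero.2 (hpN' N)) (ENNReal.inv_ne_zero.2 (hvt K hK))
  have hwt : ∀ K, K < p ^ N → w K ≠ ⊤ := fun K hK =>
    ENNReal.mul_ne_top (ENNReal.inv_ne_top.2 (hpN N)) (ENNReal.inv_ne_top.2 (hv0 K hK))
  set ν : Measure S := ∑ K ∈ Finset.range (p ^ N), w K • chartLebesgue (φ K) (D N K) with hν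
  have hνapply : ∀ B, ν B = ∑ K ∈ Finset.range (p ^ N), w K * chartLebesgue (φ K) (D N K) B :=
    fun B => by simp [hν, Measure.finsetSum_apply]
  have hcomp : ∀ K, ∃ c C : ℝ≥0∞, K < p ^ N → c ≠ ⊤ ∧ C ≠ ⊤ ∧
      chartLebesgue (φ K) (D N K) ≤ c • (riemannianVolume g).restrict (D N K) ∧
      (riemannianVolume g).restrict (D N K) ≤ C • chartLebesgue (φ K) (D N K) := fun K => by
    by_cases hK : K < p ^ N
    · obtain ⟨c, C, h⟩ := exists_chartLebesgue_comparison g (hφ K hK).1 (hmeas K hK) (hφ K hK).2.1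
        (hΩc.of_isClosed_subset isClosed_closure (closure_mono (hdec.subset N K hK)))
      exact ⟨c, C, fun _ => h⟩
    · exact ⟨0, 0, fun h => absurd h hK⟩
  choose c C hcC using hcomp
  have hle : ν ≤ (∑ K ∈ Finset.range (p ^ N), w K * c K) • (riemannianVolume g).restrict Ω := by
    refine Measure.le_iff.2 fun B _ => ?_
    rw [hνapply, Measure.smul_apply, smul_eq_mul, Finset.sum_mul]
    refine Finset.sum_le_sum fun K hK => ?_
    rw [Finset.mem_range] at hK
    refine (mul_le_mul_of_nonneg_left (((hcC K hK).2.2.1 B).trans ?_) zero_le).trans_eq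
      (mul_assoc _ _ _).symm
    rw [Measure.smul_apply, smul_eq_mul]
    gcongr
    exact hdec.subset N K hK
  have hlet : (∑ K ∈ Finset.range (p ^ N), w K * c K) ≠ ⊤ :=
    ENNReal.sum_ne_top.2 fun K hK => ENNReal.mul_ne_top (hwt K (Finset.mem_range.1 hK))
      (hcC K (Finset.mem_range.1 hK)).1
  have hac : ν ≪ riemannianVolume g :=
    (Measure.absolutelyContinuous_of_le_smul hle).trans
      Measure.restrict_le_self.absolutelyContinuous
  have hdecν := hdec.mono_ac hac
  refine ⟨ν, ⟨?_⟩, ⟨∑ K ∈ Finset.range (p ^ N), C K * (w K)⁻¹, ?_, ?_⟩, ⟨_, hlet, hle⟩,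
    hdecν.measure_eq_of_eventually (N := N) fun n k hn hk => ?_⟩
  · rw [hνapply, ENNReal.sum_lt_top]
    intro K hK
    rw [Finset.mem_range] at hK
    refine ENNReal.mul_lt_top (hwt K hK).lt_top ?_
    rw [chartLebesgue_apply _ _ MeasurableSet.univ.nullMeasurableSet]
    refine (measure_mono (Set.subset_univ _)).trans_lt ?_
    rw [Measure.restrict_apply_univ]
    exact (hvt K hK).lt_top
  · exact ENNReal.sum_ne_top.2 fun K hK => ENNReal.mul_ne_top (hcC K (Finset.mem_range.1 hK)).2.1
      (ENNReal.inv_ne_top.2 (hw0 K (Finset.mem_range.1 hK)))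
  · refine Measure.le_iff.2 fun B hB => ?_
    rw [Measure.smul_apply, smul_eq_mul, Finset.sum_mul, Measure.restrict_apply hB]
    -- The pieces of generation N cover Ω up to a null set.
    have h1 : riemannianVolume g (B ∩ Ω) ≤
        riemannianVolume g (⋃ K ∈ Finset.range (p ^ N), B ∩ D N K) := by
      refine measure_mono_ae ?_
      filter_upwards [hdec.ae_mem_generation N] with x hx hxB
      obtain ⟨K, hK, hxK⟩ := hx hxB.2
      exact Set.mem_biUnion (Finset.mem_coe.2 (Finset.mem_range.2 hK)) ⟨hxB.1, hxK⟩
    refine h1.trans ((measure_biUnion_finset_le _ _).trans (Finset.sum_le_sum fun K hK => ?_))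
    have hK' := Finset.mem_range.1 hK
    rw [← Measure.restrict_apply hB]
    refine ((hcC K hK').2.2.2 B).trans ?_
    rw [Measure.smul_apply, smul_eq_mul, mul_assoc]
    gcongr
    rw [← ENNReal.mul_le_iff_le_inv (hw0 K hK') (hwt K hK'), hνapply]
    exact Finset.single_le_sum (f := fun K => w K * chartLebesgue (φ K) (D N K) B)
      (fun _ _ => zero_le) hK
  · obtain ⟨m, rfl⟩ : ∃ m, n = N + m := ⟨n - N, by omega⟩
    obtain ⟨K, hK, k', hk', rfl⟩ := exists_ancestor_index hk
    have hsub := (hdec.subset_ancestor hK m k' hk').2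
    have hnull : ∀ K', K' < p ^ N → NullMeasurableSet (D (N + m) (p ^ m * K + k'))
        (chartLebesgue (φ K') (D N K')) := fun K' hK' =>
      (hdec.measurable _ _ hk).mono_ac
        ((Measure.absolutelyContinuous_of_le_smul (hcC K' hK').2.2.1).trans
          Measure.restrict_le_self.absolutelyContinuous)
    -- Only the ancestor K contributes, the other pieces of generation N being disjoint from it.
    -- Strong balance in its chart gives p^(-N) · p^(-m).
    rw [hνapply, Finset.sum_eq_single_of_mem K (Finset.mem_range.2 hK)]
    · have hin : inChart (φ K) (D (N + m) (p ^ m * K + k')) ⊆ inChart (φ K) (D N K) :=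
        fun u hu => ⟨hu.1, hsub hu.2⟩
      rw [chartLebesgue_apply _ _ (hnull K hK), Measure.restrict_eq_self _ hin,
        (hφ K hK).2.2.2.2.2.2.strongly_balanced m k' hk']
      change ((p : ℝ≥0∞) ^ N)⁻¹ * (v K)⁻¹ * (v K / (p : ℝ≥0∞) ^ m) = _
      rw [ENNReal.div_eq_inv_mul, mul_mul_mul_comm, ENNReal.inv_mul_cancel (hv0 K hK) (hvt K hK),
        mul_one, pow_add, ENNReal.mul_inv (Or.inl (hpN N)) (Or.inl (hpN' N))]
    · intro K' hK' hne
      have hK'' := Finset.mem_range.1 hK'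
      have : inChart (φ K') (D (N + m) (p ^ m * K + k')) ∩ inChart (φ K') (D N K') = ∅ := by
        refine Set.eq_empty_of_forall_notMem fun u hu => ?_
        exact Set.disjoint_left.1 (hdec.disjoint N K K' hK hK'' hne.symm) (hsub hu.1.2) hu.2.2
      rw [chartLebesgue_apply _ _ (hnull K' hK''),
        Measure.restrict_apply' ((hφ K' hK'').2.2.1.measurableSet), this, measure_empty, mul_zero]

end IsRegularStronglyBalanced

/-! ### The proposition -/

theorem proposition4p2 {d p : ℕ} (hd : 0 < d) [p.AtLeastTwo] {S : Type*} [TopologicalSpace S]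
    [T2Space S] [SecondCountableTopology S] [ChartedSpace (EuclideanSpace ℝ (Fin d)) S]
    [IsManifold (𝓡 d) ∞ S] [MeasurableSpace S] [BorelSpace S] (g : SmoothMetric d S)
    (Ω : Set S) (hΩ : IsOpen Ω) (hΩc : IsCompact (closure Ω)) (D : ℕ → ℕ → Set S)
    (hD : IsRegularStronglyBalanced g p Ω D) (r s : ℝ) (hr : 0 ≤ r) (hs0 : 0 ≤ s) (hs1 : s < 1)
    (hs : s ≤ r * d) :
    ∃ T : WeightedSeq p r →L[ℂ] ApproxSpace ((riemannianVolume g).restrict Ω) p d D s,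
      (∀ a : TreeIndex p →₀ ℂ,
        ApproxSpace.toL2 _ p d D s (T (WeightedSeq.ofFinsupp p r a)) =
          identMap ((riemannianVolume g).restrict Ω) p Ω D a) ∧
      (∀ T' : WeightedSeq p r →L[ℂ] ApproxSpace ((riemannianVolume g).restrict Ω) p d D s,
        (∀ a : TreeIndex p →₀ ℂ,
          ApproxSpace.toL2 _ p d D s (T' (WeightedSeq.ofFinsupp p r a)) =
            identMap ((riemannianVolume g).restrict Ω) p Ω D a) → T' = T) ∧
      Function.Injective T ∧
      (s = r * d →
        ∃ e : WeightedSeq p r ≃L[ℂ] ApproxSpace ((riemannianVolume g).restrict Ω) p d D s,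
          ∀ a, e a = T a) := by
  obtain ⟨ν, hνfin, ⟨C, hC, hμν⟩, ⟨C', hC', hνμ⟩, hbal⟩ := hD.exists_balanced_measure hΩc
  have hac := Measure.absolutelyContinuous_of_le_smul hνμ
  have hdec := hD.decomposition.mono_ac
    (hac.trans Measure.restrict_le_self.absolutelyContinuous)
  -- Finiteness of the volume of Ω follows from domination by the finite measure ν.
  have hfin : IsFiniteMeasure ((riemannianVolume g).restrict Ω) := by
    refine ⟨(hμν Set.univ).trans_lt ?_⟩
    rw [Measure.smul_apply, smul_eq_mul]
    exact ENNReal.mul_lt_top hC.lt_top (measure_lt_top ν _)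
  refine exists_identification_of_comparable hd hC hμν hC' hνμ hdec hbal
    (hdec.dense_span fun B hB => ?_) hr hs0 hs
  have h1 : ∀ᵐ x ∂ν, x ∈ Ω := hac.ae_le (ae_restrict_mem hΩ.measurableSet)
  filter_upwards [h1, ae_all_iff.2 hdec.ae_mem_generation] with x hxΩ hx hxB
  exact hD.eventually_subset hd (fun n => hx n hxΩ) hB hxB

end
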